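/- Fix integers $d_{\rm in}\ge 0$, $b\ge 0$, $d_{\rm blk}\ge 1$, a constant $c>0$, and inputs $x,x'\in\mathbb R^{d_{\rm in}}$. For each width $w$ consider the residual network with blocks $0,1,\dots,b+1$, each a fully connected network of $d_{\rm blk}$ layers without biases, in which every layer has $w$ nodes, except that the last layer of block $b+1$ has a single node (the output, without activation). Block $0$ receives the input $x$; block $1$ receives the output of block $0$; and for $1\le k\le b$ block $k+1$ receives the sum of the input and the output of block $k$ (identity skip connection around block $k$). The deep gated network (DGN) consists of two copies of this network. The gating network, with weights $\Theta^{\rm f}$, uses ReLU activations $q\mapsto q\,\mathbf 1_{\{q>0\}}$ at all nodes of all layers but the output layer, and defines the gates $G_x(k,m,j)=\mathbf 1_{\{q_x(k,m,j)>0\}}$, where $q_x(k,m,j)$ is the pre-activation, on input $x$, of node $j$ of layer $m$ of block $k$. The weight network, with weights $\Theta^{\rm v}$, is fed the same input $x$, and each of its non-output nodes multiplies its pre-activation by the gate $G_x$ of the corresponding node of the gating network. Its output is $\hat y_{\Theta^{\rm f},\Theta^{\rm v}}(x)$. Put $$\mathrm{NTK}(x,x')=\langle\nabla\hat y(x),\nabla\hat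 y(x')\rangle ,$$ where the gradient is taken with respect to all weights $(\Theta^{\rm f},\Theta^{\rm v})$; partial derivatives with respect to entries of $\Theta^{\rm f}$ are taken to be $0$ where they do not exist (at the switching points of the gates; they vanish wherever they exist). For $J\subseteq[b]=\{1,\dots,b\}$ let the $J$-th sub-network be the fully connected network of depth $(|J|+2)d_{\rm blk}$ obtained by keeping the blocks $0$, $b+1$ and those in $J$ and skipping the others. A path $p$ of it consists of an input node $i_0(p)$ and one of the $w$ nodes in each of its $(|J|+2)d_{\rm blk}-1$ hidden layers. Its feature is $\phi(x,p)=x_{i_0(p)}\prod G_x$, the product being over the hidden nodes of $p$, with the gates of the full residual gating network. Put $$\mathrm{NPK}^{J}_{\Theta^{\rm f}}(x,x')=\sum_p\phi(x,p)\,\phi(x',p).$$ Let $\sigma=c/\sqrt w$, and let $$\beta_{\rm res}^J=(|J|+2)\,d_{\rm blk}\,\sigma^{2((|J|+2)d_{\rm blk}-1)} .$$ Suppose that for every $w$ the weights $\Theta^{\rm f}$, $\Theta^{\rm v}$ are random, defined on a probability space that may depend on $w$; that the entries of $\Theta^{\rm v}$ are i.i.d. and equal to $+\sigma$ or $-\sigma$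 with probability $\tfrac12$ each; and that $\Theta^{\rm v}$ is independent of $\Theta^{\rm f}$, whose distribution is arbitrary. Then, as $w\to\infty$, $$\mathrm{NTK}(x,x')-\sum_{J\subseteq[b]}\beta_{\rm res}^J\,\mathrm{NPK}^{J}_{\Theta^{\rm f}}(x,x')\longrightarrow 0$$ in mean square (in $L^2$), and hence also in probability. -/

import Mathlib

open MeasureTheory ProbabilityTheory Filter Topology

noncomputable section

namespace ResDGN

/-! A residual network with blocks `0, 1, …, b + 1`, each a fully connected network of depth `d`
(layers `0, …, d - 1`) and width `w`, on inputs in `ℝ^din`, with scalar output. The blocks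
`1, …, b` are bypassed by identity skip connections. A layer is a pair `(k, m)`: layer `m` of
block `k`. Nodes of a layer are numbered from `0`. -/

/-- Number of nodes feeding layer `(k, m)`: `din` for the very first layer, `w` otherwise. -/
def inDim (din w k m : ℕ) : ℕ := if k = 0 ∧ m = 0 then din else w

/-- Number of nodes of layer `(k, m)`: `1` for the very last layer (the output), `w` otherwise. -/
def outDim (w b d k m : ℕ) : ℕ := if k = b + 1 ∧ m + 1 = d then 1 else w

/-- The index set of the trainable weights: a layer, an input node and an output node of it. -/
abbrev Weight (din w b d : ℕ) : Type :=
  Σ l : Fin (b + 2) × Fin d, Fin (inDim din w l.1 l.2) × Fin (outDim w b d l.1 l.2)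

/-- A parameter vector `Θ ∈ ℝ^{d_net}`. -/
abbrev Params (din w b d : ℕ) : Type := Weight din w b d → ℝ

variable {din w b d : ℕ}

/-- The weight `Θ(i, j)` of layer `(k, m)`, extended by `0` outside the network. -/
def weight (Θ : Params din w b d) (k m i j : ℕ) : ℝ :=
  if h : (k < b + 2 ∧ m < d) ∧ i < inDim din w k m ∧ j < outDim w b d k m then
    Θ ⟨(⟨k, h.1.1⟩, ⟨m, h.1.2⟩), (⟨i, h.2.1⟩, ⟨j, h.2.2⟩)⟩
  else 0

/-- The input layer: `x`, extended by `0`. -/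
def inputVec (x : Fin din → ℝ) (i : ℕ) : ℝ := if h : i < din then x ⟨i, h⟩ else 0

/-- The linear map of layer `(k, m)` applied to the vector `z`. -/
def linearLayer (Θ : Params din w b d) (k m : ℕ) (z : ℕ → ℝ) (j : ℕ) : ℝ :=
  ∑ i ∈ Finset.range (inDim din w k m), weight Θ k m i j * z i

/-- The first `m` layers of block `k` on the block input `z`; `act k m j` is the activation used
at node `j` of layer `(k, m)`. -/
def runBlock (Θ : Params din w b d) (act : ℕ → ℕ → ℕ → ℝ → ℝ) (k : ℕ) (z : ℕ → ℝ) :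
    ℕ → ℕ → ℝ
  | 0 => z
  | m + 1 => fun j => act k m j (linearLayer Θ k m (runBlock Θ act k z m) j)

/-- The input of block `k`. Block `0` receives `x`, block `1` receives the output of block `0`, and
for `1 ≤ k ≤ b` block `k + 1` receives the input of block `k` plus its output. -/
def blockInput (Θ : Params din w b d) (act : ℕ → ℕ → ℕ → ℝ → ℝ) (x : Fin din → ℝ) : ℕ → ℕ → ℝ
  | 0 => inputVec x
  | 1 => runBlock Θ act 0 (inputVec x) d
  | k + 2 => fun j =>
      blockInput Θ act x (k + 1) j + runBlock Θ act (k + 1) (blockInput Θ act x (k + 1)) d j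

/-- Pre-activation of node `j` of layer `(k, m)`. -/
def preAct (Θ : Params din w b d) (act : ℕ → ℕ → ℕ → ℝ → ℝ) (x : Fin din → ℝ) (k m j : ℕ) : ℝ :=
  linearLayer Θ k m (runBlock Θ act k (blockInput Θ act x k) m) j

/-- The output of the network: the single node of the last layer, which has no activation. -/
def netOutput (Θ : Params din w b d) (act : ℕ → ℕ → ℕ → ℝ → ℝ) (x : Fin din → ℝ) : ℝ :=
  preAct Θ act x (b + 1) (d - 1) 0

/-- Hard gating `1_{q > 0}`. -/
def step (q : ℝ) : ℝ := if 0 < q then 1 else 0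

/-- The ReLU activation `q · 1_{q > 0}`, at every node. -/
def relu (_k _m _j : ℕ) (q : ℝ) : ℝ := q * step q

/-- The gate of node `j` of layer `(k, m)` realised on input `x` by the gating network, a ReLU
residual network with parameters `Θf`. -/
def gate (Θf : Params din w b d) (x : Fin din → ℝ) (k m j : ℕ) : ℝ :=
  step (preAct Θf relu x k m j)

/-- The output of the deep gated network: the weight network has parameters `Θv`, and its gated
linear units multiply their pre-activations by the gates of the gating network. -/
def dgnOutput (Θf Θv : Params din w b d) (x : Fin din → ℝ) : ℝ :=
  netOutput Θv (fun k m j q => q * gate Θf x k m j) x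

/-- Partial derivative of the output with respect to the weight `e` of the gating network. The
output is a locally constant function of that weight except where a gate switches; there the
derivative is `0` by convention. -/
def partialGating (Θf Θv : Params din w b d) (x : Fin din → ℝ) (e : Weight din w b d) : ℝ :=
  deriv (fun t => dgnOutput (Function.update Θf e t) Θv x) (Θf e)

/-- Partial derivative of the output with respect to the weight `e` of the weight network. -/
def partialWeight (Θf Θv : Params din w b d) (x : Fin din → ℝ) (e : Weight din w b d) : ℝ :=
  deriv (fun t => dgnOutput Θf (Function.update Θv e t) x) (Θv e)

/-- The neural tangent kernel `⟨∇ ŷ(x), ∇ ŷ(x')⟩` of the deep gated network, the gradient being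
taken with respect to all its parameters `(Θf, Θv)`. -/
def ntk (Θf Θv : Params din w b d) (x x' : Fin din → ℝ) : ℝ :=
  ∑ e, partialGating Θf Θv x e * partialGating Θf Θv x' e +
    ∑ e, partialWeight Θf Θv x e * partialWeight Θf Θv x' e

/-- The hidden layers of the sub-network that keeps the blocks `0`, `b + 1` and those in `J`:
all layers of these blocks but the output layer. -/
def hiddenLayers (b d : ℕ) (J : Finset ℕ) : Finset (ℕ × ℕ) :=
  (insert 0 (insert (b + 1) J) ×ˢ Finset.range d).erase (b + 1, d - 1)

/-- The paths of the sub-network given by `J`: an input node and a node in each hidden layer. -/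
abbrev SubPath (din w b d : ℕ) (J : Finset ℕ) : Type :=
  Fin din × (↥(hiddenLayers b d J) → Fin w)

/-- Activity of a path: the product of the gates on it. -/
def activity (Θf : Params din w b d) (x : Fin din → ℝ) (J : Finset ℕ)
    (p : SubPath din w b d J) : ℝ :=
  ∏ l : ↥(hiddenLayers b d J), gate Θf x l.1.1 l.1.2 (p.2 l)

/-- The neural path feature `φ(x, p)`. -/
def pathFeature (Θf : Params din w b d) (x : Fin din → ℝ) (J : Finset ℕ)
    (p : SubPath din w b d J) : ℝ :=
  x p.1 * activity Θf x J p

/-- The neural path kernel `⟨φ(x), φ(x')⟩` of the sub-network given by `J`. -/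
def npk (Θf : Params din w b d) (J : Finset ℕ) (x x' : Fin din → ℝ) : ℝ :=
  ∑ p, pathFeature Θf x J p * pathFeature Θf x' J p

/-- `β_res^J = (|J| + 2) d σ^{2((|J| + 2) d - 1)}`. -/
def betaRes (d : ℕ) (σ : ℝ) (J : Finset ℕ) : ℝ :=
  ((J.card + 2 : ℕ) : ℝ) * (d : ℝ) * σ ^ (2 * ((J.card + 2) * d - 1))

/-- `∑_{J ⊆ [b]} β_res^J · NPK^J`. -/
def limitKernel (σ : ℝ) (Θf : Params din w b d) (x x' : Fin din → ℝ) : ℝ :=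
  ∑ J ∈ (Finset.Icc 1 b).powerset, betaRes d σ J * npk Θf J x x'

/-- The symmetric Bernoulli law on `{-σ, +σ}`. -/
def signLaw (σ : ℝ) : Measure ℝ :=
  (2⁻¹ : ENNReal) • Measure.dirac σ + (2⁻¹ : ENNReal) • Measure.dirac (-σ)

end ResDGN

end

noncomputable section

namespace ResDGN

set_option linter.unusedSectionVars false

/-! ### Averages over sign patterns -/

section SignAverage

variable {E : Type*} [Fintype E] [DecidableEq E]

/-- The average of `f` over all sign patterns. -/
def avg (f : (E → ℤˣ) → ℝ) : ℝ := (∑ ε, f ε) / Fintype.card (E → ℤˣ)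

/-- A sign as a real number. -/
def sgn (u : ℤˣ) : ℝ := ((u : ℤ) : ℝ)

lemma sgn_neg (u : ℤˣ) : sgn (-u) = -sgn u := by simp [sgn]

lemma sgn_mul_self (u : ℤˣ) : sgn u * sgn u = 1 := by
  rcases Int.units_eq_one_or u with rfl | rfl <;> simp [sgn]

lemma avg_add (f g : (E → ℤˣ) → ℝ) : avg (fun ε => f ε + g ε) = avg f + avg g := by
  simp [avg, Finset.sum_add_distrib, add_div]

lemma avg_const_mul (a : ℝ) (f : (E → ℤˣ) → ℝ) : avg (fun ε => a * f ε) = a * avg f := by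
  simp [avg, ← Finset.mul_sum, mul_div_assoc]

lemma avg_sum {ι : Type*} (T : Finset ι) (f : ι → (E → ℤˣ) → ℝ) :
    avg (fun ε => ∑ t ∈ T, f t ε) = ∑ t ∈ T, avg (f t) := by
  simp only [avg]
  rw [Finset.sum_comm, Finset.sum_div]

lemma avg_const (a : ℝ) : avg (fun _ : E → ℤˣ => a) = a := by
  have : (Fintype.card (E → ℤˣ) : ℝ) ≠ 0 := by exact_mod_cast Fintype.card_ne_zero
  simp only [avg, Finset.sum_const, Finset.card_univ, nsmul_eq_mul]
  field_simp

lemma avg_mono {f g : (E → ℤˣ) → ℝ} (h : ∀ ε, f ε ≤ g ε) : avg f ≤ avg g := by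
  unfold avg
  gcongr
  exact h _

lemma avg_nonneg {f : (E → ℤˣ) → ℝ} (h : ∀ ε, 0 ≤ f ε) : 0 ≤ avg f := by
  rw [← avg_const (E := E) 0]
  exact avg_mono h

lemma avg_eq_zero_of_flip {f : (E → ℤˣ) → ℝ} (e : E)
    (h : ∀ ε, f (Function.update ε e (-ε e)) = -f ε) : avg f = 0 := by
  have inv : Function.Involutive (fun ε : E → ℤˣ => Function.update ε e (-ε e)) := by
    intro ε
    simp
  have h1 : ∑ ε, f ε = ∑ ε, -f ε := by
    rw [← Equiv.sum_comp inv.toPerm f]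
    exact Finset.sum_congr rfl fun ε _ => h ε
  rw [Finset.sum_neg_distrib] at h1
  have : ∑ ε, f ε = 0 := by linarith
  simp [avg, this]

/-- Functions of complementary sets of signs are uncorrelated. -/
lemma avg_mul_of_dependsOn {f g : (E → ℤˣ) → ℝ} {s t : Set E} (hst : Disjoint s t)
    (hf : DependsOn f s) (hg : DependsOn g t) :
    avg (fun ε => f ε * g ε) = avg f * avg g := by
  classical
  let mix : (E → ℤˣ) × (E → ℤˣ) → (E → ℤˣ) × (E → ℤˣ) := fun p =>
    (fun e => if e ∈ s then p.1 e else p.2 e, fun e => if e ∈ s then p.2 e else p.1 e)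
  have inv : Function.Involutive mix := by
    intro p
    ext e <;> by_cases he : e ∈ s <;> simp [mix, he]
  have h1 : ∑ p : (E → ℤˣ) × (E → ℤˣ), f p.1 * g p.2 =
      ∑ p : (E → ℤˣ) × (E → ℤˣ), f p.1 * g p.1 := by
    rw [← Equiv.sum_comp inv.toPerm (fun p => f p.1 * g p.1)]
    refine Finset.sum_congr rfl fun p _ => ?_
    have e1 : f p.1 = f (mix p).1 := hf fun e he => by simp [mix, he]
    have e2 : g p.2 = g (mix p).1 := hg fun e he => by
      simp [mix, Set.disjoint_right.1 hst he]
    rw [e1, e2]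
    rfl
  have hc : (Fintype.card (E → ℤˣ) : ℝ) ≠ 0 := by exact_mod_cast Fintype.card_ne_zero
  rw [Fintype.sum_prod_type, Fintype.sum_prod_type, ← Finset.sum_mul_sum] at h1
  simp only [Finset.sum_const, Finset.card_univ, nsmul_eq_mul, ← Finset.mul_sum] at h1
  unfold avg
  rw [div_mul_div_comm, h1]
  field_simp

/-- The product of the signs in `S`. -/
def signProd (S : Finset E) (ε : E → ℤˣ) : ℝ := ∏ e ∈ S, sgn (ε e)

lemma signProd_mul_self (S : Finset E) (ε : E → ℤˣ) : signProd S ε * signProd S ε = 1 := by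
  simp [signProd, ← Finset.prod_mul_distrib, sgn_mul_self]

lemma signProd_flip (S : Finset E) (ε : E → ℤˣ) (e : E) :
    signProd S (Function.update ε e (-ε e)) =
      if e ∈ S then -signProd S ε else signProd S ε := by
  unfold signProd
  split_ifs with h
  · rw [← Finset.mul_prod_erase _ _ h, ← Finset.mul_prod_erase _ (fun e => sgn (ε e)) h]
    simp only [Function.update_self, sgn_neg, neg_mul]
    congr 2
    refine Finset.prod_congr rfl fun a ha => ?_
    rw [Function.update_of_ne (Finset.ne_of_mem_erase ha)]
  · refine Finset.prod_congr rfl fun a ha => ?_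
    rw [Function.update_of_ne]
    rintro rfl
    exact h ha

lemma avg_signProd_mul_eq_zero {S T : Finset E} (hST : S ≠ T) {f : (E → ℤˣ) → ℝ} {s : Set E}
    (hf : DependsOn f s) (hS : ∀ e ∈ S, e ∉ s) (hT : ∀ e ∈ T, e ∉ s) :
    avg (fun ε => signProd S ε * signProd T ε * f ε) = 0 := by
  obtain ⟨e, he⟩ : ∃ e, ¬ (e ∈ S ↔ e ∈ T) := by
    by_contra! h
    exact hST (Finset.ext h)
  have hes : e ∉ s := by
    by_cases h : e ∈ S
    · exact hS e h
    · exact hT e (by tauto)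
  refine avg_eq_zero_of_flip e fun ε => ?_
  have hfe : f (Function.update ε e (-ε e)) = f ε := hf fun a ha => by
    rw [Function.update_of_ne]
    rintro rfl
    exact hes ha
  rw [signProd_flip, signProd_flip, hfe]
  by_cases h : e ∈ S
  · have h' : e ∉ T := by tauto
    simp [h, h']
  · have h' : e ∈ T := by tauto
    simp [h, h']

/-- Second moment of a sum of sign products with coefficients depending on other signs. -/
lemma avg_sq_sum_signProd_le {ι : Type*} (T : Finset ι) (S : ι → Finset E)
    (F : ι → (E → ℤˣ) → ℝ) {s : Set E} (hF : ∀ t ∈ T, DependsOn (F t) s)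
    (hS : ∀ t ∈ T, ∀ e ∈ S t, e ∉ s) (M : ℕ)
    (hM : ∀ t ∈ T, (T.filter fun t' => S t' = S t).card ≤ M) :
    avg (fun ε => (∑ t ∈ T, signProd (S t) ε * F t ε) ^ 2) ≤
      M * ∑ t ∈ T, avg (fun ε => F t ε ^ 2) := by
  set A : ι → ℝ := fun t => avg (fun ε => F t ε ^ 2) with hA
  have hA0 : ∀ t, 0 ≤ A t := fun t => avg_nonneg fun ε => sq_nonneg _
  have key : ∀ t ∈ T, ∀ t' ∈ T,
      avg (fun ε => signProd (S t) ε * F t ε * (signProd (S t') ε * F t' ε)) ≤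
        if S t' = S t then (A t + A t') / 2 else 0 := by
    intro t ht t' ht'
    split_ifs with h
    · have : A t / 2 + A t' / 2 = avg (fun ε => (1 / 2) * F t ε ^ 2 + (1 / 2) * F t' ε ^ 2) := by
        rw [avg_add, avg_const_mul, avg_const_mul]
        ring
      rw [add_div, this]
      refine avg_mono fun ε => ?_
      have e1 := signProd_mul_self (S t) ε
      rw [h]
      calc signProd (S t) ε * F t ε * (signProd (S t) ε * F t' ε)
          = (signProd (S t) ε * signProd (S t) ε) * (F t ε * F t' ε) := by ring
        _ = F t ε * F t' ε := by rw [e1, one_mul]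
        _ ≤ _ := by nlinarith [sq_nonneg (F t ε - F t' ε)]
    · refine le_of_eq ?_
      rw [← avg_signProd_mul_eq_zero (Ne.symm h) (f := fun ε => F t ε * F t' ε) (s := s) _
        (hS t ht) (hS t' ht')]
      · congr 1
        ext ε
        ring
      · intro x y hxy
        simp only [hF t ht hxy, hF t' ht' hxy]
  calc avg (fun ε => (∑ t ∈ T, signProd (S t) ε * F t ε) ^ 2)
      = ∑ t ∈ T, ∑ t' ∈ T,
          avg (fun ε => signProd (S t) ε * F t ε * (signProd (S t') ε * F t' ε)) := by
        simp only [← avg_sum]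
        congr 1
        ext ε
        rw [sq, Finset.sum_mul_sum]
    _ ≤ ∑ t ∈ T, ∑ t' ∈ T, if S t' = S t then (A t + A t') / 2 else 0 :=
        Finset.sum_le_sum fun t ht => Finset.sum_le_sum fun t' ht' => key t ht t' ht'
    _ = (∑ t ∈ T, ∑ t' ∈ T, if S t' = S t then A t / 2 else 0) +
          ∑ t ∈ T, ∑ t' ∈ T, if S t' = S t then A t' / 2 else 0 := by
        simp only [← Finset.sum_add_distrib]
        refine Finset.sum_congr rfl fun t _ => Finset.sum_congr rfl fun t' _ => ?_
        split_ifs <;> ring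
    _ = 2 * ∑ t ∈ T, ∑ t' ∈ T, if S t' = S t then A t / 2 else 0 := by
        rw [two_mul]
        congr 1
        rw [Finset.sum_comm]
        refine Finset.sum_congr rfl fun t _ => Finset.sum_congr rfl fun t' _ => ?_
        simp only [eq_comm]
    _ = ∑ t ∈ T, ((T.filter fun t' => S t' = S t).card : ℝ) * A t := by
        rw [Finset.mul_sum]
        refine Finset.sum_congr rfl fun t _ => ?_
        rw [← Finset.sum_filter, Finset.sum_const, nsmul_eq_mul]
        ring
    _ ≤ ∑ t ∈ T, M * A t := by
        refine Finset.sum_le_sum fun t ht => ?_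
        exact mul_le_mul_of_nonneg_right (by exact_mod_cast hM t ht) (hA0 t)
    _ = M * ∑ t ∈ T, A t := by rw [Finset.mul_sum]

end SignAverage

section Concentration

variable {E : Type*} [Fintype E] [DecidableEq E]

/-- The random vectors `y`, `y'` have bounded fourth moments, and all weighted inner products
`∑ h i * (y i * y' i)` with weights bounded by `1` concentrate around `∑ h i * s i`. -/
structure Concentrated {ι : Type*} [Fintype ι] (w : ℝ) (y y' : (E → ℤˣ) → ι → ℝ) (s : ι → ℝ)
    (K : ℝ) : Prop where
  moment_left : avg (fun ε => (∑ i, y ε i ^ 2) ^ 2) ≤ K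
  moment_right : avg (fun ε => (∑ i, y' ε i ^ 2) ^ 2) ≤ K
  profile_le : ∑ i, |s i| ≤ K
  var_le : ∀ h : ι → ℝ, (∀ i, |h i| ≤ 1) →
    avg (fun ε => (∑ i, h i * (y ε i * y' ε i - s i)) ^ 2) ≤ K / w

variable {ι κ : Type*} [Fintype ι] [Fintype κ] {w : ℝ} {s : ι → ℝ} {K : ℝ}
  {y y' : (E → ℤˣ) → ι → ℝ}

namespace Concentrated

lemma nonneg (h : Concentrated w y y' s K) : 0 ≤ K :=
  (Finset.sum_nonneg fun _ _ => abs_nonneg _).trans h.profile_le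

lemma mono (hw : 0 < w) (h : Concentrated w y y' s K) {K' : ℝ} (hK : K ≤ K') :
    Concentrated w y y' s K' :=
  ⟨h.moment_left.trans hK, h.moment_right.trans hK, h.profile_le.trans hK,
    fun a ha => (h.var_le a ha).trans (by gcongr)⟩

end Concentrated

lemma mul_sq_le_of_abs_le_one {a t : ℝ} (ha : |a| ≤ 1) : (a * t) ^ 2 ≤ t ^ 2 := by
  rw [mul_pow]
  have : a ^ 2 ≤ 1 := (sq_le_one_iff_abs_le_one a).2 ha
  nlinarith [sq_nonneg t]

lemma abs_mul_le_one {a b : ℝ} (ha : |a| ≤ 1) (hb : |b| ≤ 1) : |a * b| ≤ 1 := by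
  rw [abs_mul]
  exact mul_le_one₀ ha (abs_nonneg _) hb

/-- Multiplying the coordinates by gates preserves concentration. -/
lemma Concentrated.mask (h : Concentrated w y y' s K) {a a' : ι → ℝ} (ha : ∀ i, |a i| ≤ 1)
    (ha' : ∀ i, |a' i| ≤ 1) :
    Concentrated w (fun ε i => a i * y ε i) (fun ε i => a' i * y' ε i)
      (fun i => a i * a' i * s i) K where
  moment_left := (avg_mono fun ε => pow_le_pow_left₀
    (Finset.sum_nonneg fun _ _ => sq_nonneg _)
    (Finset.sum_le_sum fun i _ => mul_sq_le_of_abs_le_one (ha i)) 2).trans h.moment_left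
  moment_right := (avg_mono fun ε => pow_le_pow_left₀
    (Finset.sum_nonneg fun _ _ => sq_nonneg _)
    (Finset.sum_le_sum fun i _ => mul_sq_le_of_abs_le_one (ha' i)) 2).trans h.moment_right
  profile_le := by
    refine (Finset.sum_le_sum fun i _ => ?_).trans h.profile_le
    rw [abs_mul]
    exact mul_le_of_le_one_left (abs_nonneg _) (abs_mul_le_one (ha i) (ha' i))
  var_le b hb := by
    have := h.var_le (fun i => b i * (a i * a' i))
      fun i => abs_mul_le_one (hb i) (abs_mul_le_one (ha i) (ha' i))
    convert this using 3
    refine congrArg (· ^ 2) (Finset.sum_congr rfl fun i _ => ?_)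
    ring

lemma mul_le_half_sq_add_half_sq (a b : ℝ) : a * b ≤ (1 / 2) * a ^ 2 + (1 / 2) * b ^ 2 := by
  nlinarith [sq_nonneg (a - b)]

lemma avg_mul_le {f g : (E → ℤˣ) → ℝ} (hf : avg (fun ε => f ε ^ 2) ≤ K)
    (hg : avg (fun ε => g ε ^ 2) ≤ K) : avg (fun ε => f ε * g ε) ≤ K := by
  refine (avg_mono fun ε => mul_le_half_sq_add_half_sq (f ε) (g ε)).trans ?_
  rw [avg_add, avg_const_mul, avg_const_mul]
  linarith

/-- The pre-activations of a layer: its weights are `σ` times the signs `ε (e (i, j))`. -/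
def signLayer (σ : ℝ) (e : ι × κ ↪ E) (y : (E → ℤˣ) → ι → ℝ) (ε : E → ℤˣ) (j : κ) : ℝ :=
  ∑ i, σ * sgn (ε (e (i, j))) * y ε i

/-- The signs on which the coefficients depend are not used by the layer. -/
def AvoidsLayer (e : ι × κ ↪ E) (S : Set E) : Prop := ∀ p, e p ∉ S

variable {e : ι × κ ↪ E} {S : Set E} {σ c : ℝ}

lemma avg_sq_linear_le (he : AvoidsLayer e S) {z : (E → ℤˣ) → κ → ℝ} (hz : DependsOn z S)
    (hy : DependsOn y S) (hKz : avg (fun ε => (∑ j, z ε j ^ 2) ^ 2) ≤ K)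
    (hKy : avg (fun ε => (∑ i, y ε i ^ 2) ^ 2) ≤ K) :
    avg (fun ε => (∑ j, z ε j * signLayer σ e y ε j) ^ 2) ≤ σ ^ 2 * K := by
  have h1 := avg_sq_sum_signProd_le (Finset.univ : Finset (ι × κ)) (fun p => {e p})
    (fun p ε => σ * (z ε p.2 * y ε p.1)) (s := S)
    (fun p _ x x' hx => by simp only [hz hx, hy hx])
    (fun p _ a ha => by rw [Finset.mem_singleton.1 ha]; exact he p) 1
    (fun p _ => by
      rw [Finset.card_le_one]
      intro a ha b hb
      simp only [Finset.singleton_inj, EmbeddingLike.apply_eq_iff_eq, Finset.mem_filter] at ha hb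
      rw [ha.2, hb.2])
  calc avg (fun ε => (∑ j, z ε j * signLayer σ e y ε j) ^ 2)
      = avg (fun ε => (∑ p : ι × κ, signProd {e p} ε * (σ * (z ε p.2 * y ε p.1))) ^ 2) := by
        congr 1
        ext ε
        congr 1
        simp only [signLayer, signProd, Finset.prod_singleton, Finset.mul_sum]
        rw [Fintype.sum_prod_type, Finset.sum_comm]
        refine Finset.sum_congr rfl fun i _ => Finset.sum_congr rfl fun j _ => ?_
        ring
    _ ≤ _ := h1
    _ = σ ^ 2 * avg (fun ε => (∑ j, z ε j ^ 2) * ∑ i, y ε i ^ 2) := by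
        rw [← avg_sum, Nat.cast_one, one_mul, ← avg_const_mul]
        congr 1
        ext ε
        rw [Finset.sum_mul_sum, Finset.sum_comm, Fintype.sum_prod_type, Finset.mul_sum]
        refine Finset.sum_congr rfl fun i _ => ?_
        rw [Finset.mul_sum]
        refine Finset.sum_congr rfl fun j _ => ?_
        ring
    _ ≤ _ := mul_le_mul_of_nonneg_left (avg_mul_le hKz hKy) (sq_nonneg σ)

/-- The off-diagonal part of a weighted inner product of two pre-activation vectors. -/
def offDiagonal (σ : ℝ) (e : ι × κ ↪ E) (y y' : (E → ℤˣ) → ι → ℝ) (b : κ → ℝ)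
    (ε : E → ℤˣ) : ℝ :=
  ∑ j, b j * (signLayer σ e y ε j * signLayer σ e y' ε j) -
    σ ^ 2 * (∑ j, b j) * ∑ i, y ε i * y' ε i

lemma offDiagonal_eq [DecidableEq ι] (b : κ → ℝ) (ε : E → ℤˣ) :
    offDiagonal σ e y y' b ε =
      ∑ t ∈ (Finset.univ : Finset (κ × ι × ι)).filter (fun t => t.2.1 ≠ t.2.2),
        signProd {e (t.2.1, t.1), e (t.2.2, t.1)} ε *
          (σ ^ 2 * b t.1 * (y ε t.2.1 * y' ε t.2.2)) := by
  have h1 : ∀ t ∈ (Finset.univ : Finset (κ × ι × ι)).filter (fun t => t.2.1 ≠ t.2.2),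
      signProd {e (t.2.1, t.1), e (t.2.2, t.1)} ε * (σ ^ 2 * b t.1 * (y ε t.2.1 * y' ε t.2.2)) =
      sgn (ε (e (t.2.1, t.1))) * sgn (ε (e (t.2.2, t.1))) *
        (σ ^ 2 * b t.1 * (y ε t.2.1 * y' ε t.2.2)) := by
    intro t ht
    have hne : e (t.2.1, t.1) ≠ e (t.2.2, t.1) := by
      simpa using (Finset.mem_filter.1 ht).2
    rw [signProd, Finset.prod_pair hne]
  have h0 : σ ^ 2 * (∑ j, b j) * ∑ i, y ε i * y' ε i =
      ∑ j, σ ^ 2 * b j * ∑ i, y ε i * y' ε i := by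
    rw [← Finset.sum_mul, ← Finset.mul_sum]
  rw [Finset.sum_congr rfl h1, offDiagonal, sub_eq_iff_eq_add, Finset.sum_filter,
    Fintype.sum_prod_type, h0, ← Finset.sum_add_distrib]
  refine Finset.sum_congr rfl fun j _ => ?_
  simp only [signLayer]
  rw [Finset.sum_mul_sum, Fintype.sum_prod_type, Finset.mul_sum, Finset.mul_sum,
    ← Finset.sum_add_distrib]
  refine Finset.sum_congr rfl fun i _ => ?_
  have hs := sgn_mul_self (ε (e (i, j)))
  have h2 : ∀ i' ∈ Finset.univ.erase i, (if i ≠ i' then sgn (ε (e (i, j))) * sgn (ε (e (i', j))) *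
        (σ ^ 2 * b j * (y ε i * y' ε i')) else 0) =
      b j * (σ * sgn (ε (e (i, j))) * y ε i * (σ * sgn (ε (e (i', j))) * y' ε i')) := by
    intro i' hi'
    rw [if_pos (Finset.ne_of_mem_erase hi').symm]
    ring
  dsimp only
  rw [← Finset.add_sum_erase _ _ (Finset.mem_univ i), mul_add,
    ← Finset.add_sum_erase _ (fun i' => if i ≠ i' then sgn (ε (e (i, j))) * sgn (ε (e (i', j))) *
        (σ ^ 2 * b j * (y ε i * y' ε i')) else 0) (Finset.mem_univ i),
    Finset.sum_congr rfl h2, ← Finset.mul_sum _ _ (b j)]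
  simp only [ne_eq, not_true_eq_false, if_false]
  linear_combination (b j * σ ^ 2 * y ε i * y' ε i) * hs

lemma avg_sq_offDiagonal_le (he : AvoidsLayer e S) (hy : DependsOn y S) (hy' : DependsOn y' S)
    (hKy : avg (fun ε => (∑ i, y ε i ^ 2) ^ 2) ≤ K)
    (hKy' : avg (fun ε => (∑ i, y' ε i ^ 2) ^ 2) ≤ K) {b : κ → ℝ} (hb : ∀ j, |b j| ≤ 1) :
    avg (fun ε => offDiagonal σ e y y' b ε ^ 2) ≤ 2 * (σ ^ 4 * Fintype.card κ * K) := by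
  classical
  set T := (Finset.univ : Finset (κ × ι × ι)).filter (fun t => t.2.1 ≠ t.2.2) with hT
  have h1 := avg_sq_sum_signProd_le T
    (fun t => {e (t.2.1, t.1), e (t.2.2, t.1)})
    (fun t ε => σ ^ 2 * b t.1 * (y ε t.2.1 * y' ε t.2.2)) (s := S)
    (fun p _ x x' hx => by simp only [hy' hx, hy hx])
    (fun t _ a ha => by
      simp only [Finset.mem_insert, Finset.mem_singleton] at ha
      rcases ha with rfl | rfl <;> exact he _) 2
    (fun t ht => by
      refine (Finset.card_le_card (t := {t, (t.1, t.2.2, t.2.1)}) ?_).trans Finset.card_le_two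
      rintro ⟨j', i1, i2⟩ ht'
      obtain ⟨j, i, i'⟩ := t
      simp only [hT, Finset.mem_filter, Finset.mem_univ, true_and] at ht ht'
      obtain ⟨hne, heq⟩ := ht'
      have m1 : e (i1, j') ∈ ({e (i, j), e (i', j)} : Finset E) := by rw [← heq]; simp
      have m2 : e (i2, j') ∈ ({e (i, j), e (i', j)} : Finset E) := by rw [← heq]; simp
      simp only [Finset.mem_insert, Finset.mem_singleton, EmbeddingLike.apply_eq_iff_eq,
        Prod.mk.injEq] at m1 m2 ⊢
      obtain ⟨a1, a2⟩ | ⟨a1, a2⟩ := m1 <;> obtain ⟨a3, a4⟩ | ⟨a3, a4⟩ := m2 <;> grind)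
  simp only [offDiagonal_eq]
  refine h1.trans ?_
  rw [Nat.cast_ofNat]
  refine mul_le_mul_of_nonneg_left ?_ zero_le_two
  rw [← avg_sum]
  calc avg (fun ε => ∑ t ∈ T, (σ ^ 2 * b t.1 * (y ε t.2.1 * y' ε t.2.2)) ^ 2)
      ≤ avg (fun ε => σ ^ 4 * Fintype.card κ * ((∑ i, y ε i ^ 2) * ∑ i, y' ε i ^ 2)) := by
        refine avg_mono fun ε => ?_
        calc ∑ t ∈ T, (σ ^ 2 * b t.1 * (y ε t.2.1 * y' ε t.2.2)) ^ 2
            ≤ ∑ t : κ × ι × ι, σ ^ 4 * (y ε t.2.1 ^ 2 * y' ε t.2.2 ^ 2) := by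
              refine (Finset.sum_le_univ_sum_of_nonneg fun t => sq_nonneg _).trans ?_
              refine Finset.sum_le_sum fun t _ => ?_
              calc (σ ^ 2 * b t.1 * (y ε t.2.1 * y' ε t.2.2)) ^ 2
                  = (b t.1 * (σ ^ 2 * (y ε t.2.1 * y' ε t.2.2))) ^ 2 := by ring
                _ ≤ _ := mul_sq_le_of_abs_le_one (hb _)
                _ = _ := by ring
          _ = _ := by
              rw [Fintype.sum_prod_type]
              simp only [Finset.sum_const, Finset.card_univ, nsmul_eq_mul, ← Finset.mul_sum]
              rw [Fintype.sum_prod_type, Finset.sum_mul_sum]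
              ring
    _ = σ ^ 4 * Fintype.card κ * avg (fun ε => (∑ i, y ε i ^ 2) * ∑ i, y' ε i ^ 2) :=
        avg_const_mul _ _
    _ ≤ _ := mul_le_mul_of_nonneg_left (avg_mul_le hKy hKy') (by positivity)

lemma avg_sq_add_le {f g : (E → ℤˣ) → ℝ} {A B : ℝ} (hf : avg (fun ε => f ε ^ 2) ≤ A)
    (hg : avg (fun ε => g ε ^ 2) ≤ B) : avg (fun ε => (f ε + g ε) ^ 2) ≤ 2 * A + 2 * B := by
  calc avg (fun ε => (f ε + g ε) ^ 2) ≤ avg (fun ε => 2 * f ε ^ 2 + 2 * g ε ^ 2) :=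
        avg_mono fun ε => by nlinarith [sq_nonneg (f ε - g ε)]
    _ = 2 * avg (fun ε => f ε ^ 2) + 2 * avg (fun ε => g ε ^ 2) := by
        rw [avg_add, avg_const_mul, avg_const_mul]
    _ ≤ _ := by linarith

lemma sigma_card_le (hw : 0 < w) (hσ : σ ^ 2 * w = c ^ 2) (hκ : (Fintype.card κ : ℝ) ≤ w) :
    σ ^ 2 * Fintype.card κ ≤ c ^ 2 ∧ σ ^ 4 * Fintype.card κ ≤ c ^ 4 / w := by
  have h1 : σ ^ 2 * Fintype.card κ ≤ c ^ 2 :=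
    hσ ▸ mul_le_mul_of_nonneg_left hκ (sq_nonneg σ)
  refine ⟨h1, ?_⟩
  rw [le_div_iff₀ hw]
  calc σ ^ 4 * Fintype.card κ * w = (σ ^ 2 * Fintype.card κ) * (σ ^ 2 * w) := by ring
    _ ≤ c ^ 2 * c ^ 2 := by rw [hσ]; exact mul_le_mul_of_nonneg_right h1 (sq_nonneg c)
    _ = c ^ 4 := by ring

lemma moment_signLayer_le (hw : 1 ≤ w) (hσ : σ ^ 2 * w = c ^ 2)
    (hκ : (Fintype.card κ : ℝ) ≤ w) (he : AvoidsLayer e S) (hy : DependsOn y S)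
    (hK : 0 ≤ K) (hKy : avg (fun ε => (∑ i, y ε i ^ 2) ^ 2) ≤ K) :
    avg (fun ε => (∑ j, signLayer σ e y ε j ^ 2) ^ 2) ≤ 6 * c ^ 4 * K := by
  have hw0 : 0 < w := by linarith
  obtain ⟨h1, h2⟩ := sigma_card_le hw0 hσ hκ
  have h3 := avg_sq_offDiagonal_le (σ := σ) (b := fun _ : κ => (1 : ℝ)) he hy hy hKy hKy
    (fun j => by simp)
  have h4 : avg (fun ε => (σ ^ 2 * Fintype.card κ * ∑ i, y ε i ^ 2) ^ 2) ≤ c ^ 4 * K := by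
    simp only [mul_pow _ (∑ i, _)]
    rw [avg_const_mul]
    have : (σ ^ 2 * (Fintype.card κ : ℝ)) ^ 2 ≤ (c ^ 2) ^ 2 := by gcongr
    calc _ ≤ (c ^ 2) ^ 2 * K :=
          mul_le_mul this hKy (avg_nonneg fun _ => by positivity) (by positivity)
      _ = _ := by ring
  have h5 := avg_sq_add_le h4 h3
  have h6 : σ ^ 4 * Fintype.card κ ≤ c ^ 4 :=
    h2.trans (div_le_self (by positivity) hw)
  have h7 : σ ^ 4 * Fintype.card κ * K ≤ c ^ 4 * K := mul_le_mul_of_nonneg_right h6 hK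
  refine le_trans (le_of_eq ?_) (h5.trans (by linarith))
  congr 1
  ext ε
  congr 1
  simp only [offDiagonal, Finset.sum_const, Finset.card_univ, nsmul_eq_mul, mul_one, one_mul,
    ← sq]
  ring

/-- A layer with fresh random signs preserves concentration. -/
lemma Concentrated.linear (hw : 1 ≤ w) (hσ : σ ^ 2 * w = c ^ 2)
    (hκ : (Fintype.card κ : ℝ) ≤ w) (he : AvoidsLayer e S) (hy : DependsOn y S)
    (hy' : DependsOn y' S) (h : Concentrated w y y' s K) :
    Concentrated w (signLayer σ e y) (signLayer σ e y') (fun _ => σ ^ 2 * ∑ i, s i)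
      ((6 * c ^ 4 + c ^ 2) * K) := by
  have hw0 : 0 < w := by linarith
  have hK := h.nonneg
  obtain ⟨h1, h2⟩ := sigma_card_le hw0 hσ hκ
  have hc2 : 0 ≤ c ^ 2 * K := by positivity
  have hc4 : 0 ≤ c ^ 4 * K := by positivity
  refine ⟨?_, ?_, ?_, ?_⟩
  · exact (moment_signLayer_le hw hσ hκ he hy hK h.moment_left).trans (by linarith)
  · exact (moment_signLayer_le hw hσ hκ he hy' hK h.moment_right).trans (by linarith)
  · calc ∑ _j : κ, |σ ^ 2 * ∑ i, s i| = σ ^ 2 * Fintype.card κ * |∑ i, s i| := by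
          simp only [Finset.sum_const, Finset.card_univ, nsmul_eq_mul, abs_mul, abs_sq]
          ring
      _ ≤ c ^ 2 * K := mul_le_mul h1 ((Finset.abs_sum_le_sum_abs _ _).trans h.profile_le)
          (abs_nonneg _) (sq_nonneg c)
      _ ≤ _ := by linarith
  · intro b hb
    have h3 := avg_sq_offDiagonal_le (σ := σ) he hy hy' h.moment_left h.moment_right hb
    have hB : (σ ^ 2 * ∑ j, b j) ^ 2 ≤ (c ^ 2) ^ 2 := by
      refine sq_le_sq' ?_ ?_
      all_goals
        have : |∑ j, b j| ≤ Fintype.card κ := by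
          refine (Finset.abs_sum_le_sum_abs _ _).trans ?_
          refine (Finset.sum_le_sum fun j _ => hb j).trans ?_
          simp
        have h5 : σ ^ 2 * |∑ j, b j| ≤ c ^ 2 :=
          (mul_le_mul_of_nonneg_left this (sq_nonneg σ)).trans h1
        have h6 : |σ ^ 2 * ∑ j, b j| ≤ c ^ 2 := by
          rwa [abs_mul, abs_of_nonneg (sq_nonneg σ)]
        have := abs_le.1 h6
        linarith
    have h4 : avg (fun ε => (σ ^ 2 * (∑ j, b j) * ∑ i, 1 * (y ε i * y' ε i - s i)) ^ 2) ≤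
        c ^ 4 * K / w := by
      have h0 : ∀ X, (σ ^ 2 * (∑ j, b j) * X) ^ 2 = (σ ^ 2 * ∑ j, b j) ^ 2 * X ^ 2 :=
        fun X => mul_pow _ _ _
      simp only [h0]
      rw [avg_const_mul]
      calc _ ≤ (c ^ 2) ^ 2 * (K / w) :=
            mul_le_mul hB (h.var_le (fun _ => 1) fun i => by simp)
              (avg_nonneg fun _ => by positivity) (by positivity)
        _ = _ := by ring
    have h5 := avg_sq_add_le h4 h3
    have h7 : σ ^ 4 * Fintype.card κ * K ≤ c ^ 4 * K / w := by
      calc _ ≤ c ^ 4 / w * K := mul_le_mul_of_nonneg_right h2 hK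
        _ = _ := by ring
    have h8 : 0 ≤ c ^ 2 * K / w := by positivity
    have h9 : 0 ≤ c ^ 4 * K / w := by positivity
    refine le_trans (le_of_eq ?_) (h5.trans ?_)
    · congr 1
      ext ε
      congr 1
      simp only [offDiagonal, mul_sub, Finset.sum_sub_distrib, one_mul, ← Finset.sum_mul]
      ring
    · calc _ ≤ 6 * (c ^ 4 * K / w) := by linarith
        _ ≤ 6 * (c ^ 4 * K / w) + c ^ 2 * K / w := by linarith
        _ = _ := by ring

lemma sum_add_sq_le (f g : ι → ℝ) :
    ∑ i, (f i + g i) ^ 2 ≤ 2 * ∑ i, f i ^ 2 + 2 * ∑ i, g i ^ 2 := by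
  rw [Finset.mul_sum, Finset.mul_sum, ← Finset.sum_add_distrib]
  exact Finset.sum_le_sum fun i _ => by nlinarith [sq_nonneg (f i - g i)]

lemma moment_add_le (hy : avg (fun ε => (∑ i, y ε i ^ 2) ^ 2) ≤ K)
    (hy' : avg (fun ε => (∑ i, y' ε i ^ 2) ^ 2) ≤ K) :
    avg (fun ε => (∑ i, (y ε i + y' ε i) ^ 2) ^ 2) ≤ 16 * K := by
  have h4 : ∀ {y : (E → ℤˣ) → ι → ℝ}, avg (fun ε => (∑ i, y ε i ^ 2) ^ 2) ≤ K →
      avg (fun ε => (2 * ∑ i, y ε i ^ 2) ^ 2) ≤ 4 * K := by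
    intro y hy
    simp only [mul_pow]
    rw [avg_const_mul]
    linarith
  have := avg_sq_add_le (h4 hy) (h4 hy')
  refine (avg_mono fun ε => ?_).trans (this.trans (by linarith))
  exact pow_le_pow_left₀ (Finset.sum_nonneg fun _ _ => sq_nonneg _) (sum_add_sq_le _ _) 2

/-- Adding a gated layer with fresh random signs to a skip connection preserves concentration. -/
lemma Concentrated.add_layer (hw : 1 ≤ w) (hσ : σ ^ 2 * w = c ^ 2)
    (hκ : (Fintype.card κ : ℝ) ≤ w) (he : AvoidsLayer e S) (hy : DependsOn y S)
    (hy' : DependsOn y' S) (h : Concentrated w y y' s K) {a a' : κ → ℝ}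
    (ha : ∀ j, |a j| ≤ 1) (ha' : ∀ j, |a' j| ≤ 1)
    {z z' : (E → ℤˣ) → κ → ℝ} {sz : κ → ℝ} (hz : DependsOn z S) (hz' : DependsOn z' S)
    (hzz : Concentrated w z z' sz K) :
    Concentrated w (fun ε j => z ε j + a j * signLayer σ e y ε j)
      (fun ε j => z' ε j + a' j * signLayer σ e y' ε j)
      (fun j => sz j + a j * a' j * (σ ^ 2 * ∑ i, s i))
      (16 * (1 + (6 * c ^ 4 + c ^ 2)) * K) := by
  have hw0 : 0 < w := by linarith
  have hK := h.nonneg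
  set K2 := (1 + (6 * c ^ 4 + c ^ 2)) * K with hK2
  have hKK2 : K ≤ K2 := by
    have : 0 ≤ (6 * c ^ 4 + c ^ 2) * K := by positivity
    rw [hK2]; linarith
  have hK20 : 0 ≤ K2 := hK.trans hKK2
  have hq := ((h.linear hw hσ hκ he hy hy').mask ha ha').mono hw0 (K' := K2)
    (by rw [hK2]; linarith)
  have hz2 := hzz.mono hw0 hKK2
  rw [mul_assoc, ← hK2]
  refine ⟨moment_add_le hz2.moment_left hq.moment_left,
    moment_add_le hz2.moment_right hq.moment_right, ?_, ?_⟩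
  · refine (Finset.sum_le_sum fun j _ => abs_add_le _ _).trans ?_
    rw [Finset.sum_add_distrib]
    have := hz2.profile_le
    have := hq.profile_le
    linarith
  · intro b hb
    have hσ2 : σ ^ 2 * K ≤ K2 / w := by
      rw [le_div_iff₀ hw0]
      calc σ ^ 2 * K * w = (σ ^ 2 * w) * K := by ring
        _ = c ^ 2 * K := by rw [hσ]
        _ ≤ K2 := by
          have : 0 ≤ c ^ 4 * K := by positivity
          rw [hK2]; linarith
    have cross : ∀ {y : (E → ℤˣ) → ι → ℝ} {z : (E → ℤˣ) → κ → ℝ} {a : κ → ℝ},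
        (∀ j, |a j| ≤ 1) → DependsOn y S → DependsOn z S →
        avg (fun ε => (∑ j, z ε j ^ 2) ^ 2) ≤ K → avg (fun ε => (∑ i, y ε i ^ 2) ^ 2) ≤ K →
        avg (fun ε => (∑ j, b j * a j * z ε j * signLayer σ e y ε j) ^ 2) ≤ K2 / w := by
      intro y z a ha hy hz hKz hKy
      refine (avg_sq_linear_le (z := fun ε j => b j * a j * z ε j) he ?_ hy ?_ hKy).trans hσ2
      · intro x x' hx
        simp only [hz hx]
      · refine (avg_mono fun ε => pow_le_pow_left₀ (Finset.sum_nonneg fun _ _ => sq_nonneg _)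
          (Finset.sum_le_sum fun j _ => ?_) 2).trans hKz
        exact mul_sq_le_of_abs_le_one (abs_mul_le_one (hb j) (ha j))
    have c1 := cross ha' hy' hz hzz.moment_left h.moment_right
    have c2 := cross ha hy hz' hzz.moment_right h.moment_left
    have := avg_sq_add_le (avg_sq_add_le (hz2.var_le b hb) (hq.var_le b hb))
      (avg_sq_add_le c1 c2)
    refine le_trans (le_of_eq ?_) (this.trans ?_)
    · congr 1
      ext ε
      congr 1
      simp only [← Finset.sum_add_distrib]
      refine Finset.sum_congr rfl fun j _ => ?_
      ring
    · have : 0 ≤ K2 / w := by positivity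
      calc _ ≤ 16 * (K2 / w) := by linarith
        _ = _ := by ring

/-- The product of two independent concentrating inner products concentrates. -/
lemma avg_sq_inner_mul_inner_sub_le (hw : 1 ≤ w) {S T : Set E} (hST : Disjoint S T)
    (h : Concentrated w y y' s K) {z z' : (E → ℤˣ) → κ → ℝ} {sz : κ → ℝ}
    (hz : Concentrated w z z' sz K) (dy : DependsOn y S) (dy' : DependsOn y' S)
    (dz : DependsOn z T) (dz' : DependsOn z' T) :
    avg (fun ε => ((∑ i, y ε i * y' ε i) * (∑ j, z ε j * z' ε j) -
      (∑ i, s i) * ∑ j, sz j) ^ 2) ≤ (2 * K ^ 2 + 2 * K ^ 3) / w := by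
  have hw0 : 0 < w := by linarith
  have hK := h.nonneg
  have v1 := h.var_le (fun _ => 1) fun _ => by simp
  have v2 := hz.var_le (fun _ => 1) fun _ => by simp
  simp only [one_mul, Finset.sum_sub_distrib] at v1 v2
  have m2 : avg (fun ε => (∑ j, z ε j * z' ε j) ^ 2) ≤ K := by
    refine (avg_mono fun ε => ?_).trans (avg_mul_le hz.moment_left hz.moment_right)
    exact Finset.sum_mul_sq_le_sq_mul_sq _ _ _
  have e1 : avg (fun ε => (((∑ i, y ε i * y' ε i) - ∑ i, s i) * ∑ j, z ε j * z' ε j) ^ 2) ≤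
      K / w * K := by
    simp only [mul_pow]
    rw [avg_mul_of_dependsOn hST]
    · exact mul_le_mul v1 m2 (avg_nonneg fun _ => sq_nonneg _) (by positivity)
    · intro x x' hx
      simp only [dy hx, dy' hx]
    · intro x x' hx
      simp only [dz hx, dz' hx]
  have e2 : avg (fun ε => ((∑ i, s i) * ((∑ j, z ε j * z' ε j) - ∑ j, sz j)) ^ 2) ≤
      K ^ 2 * (K / w) := by
    simp only [mul_pow]
    rw [avg_const_mul]
    refine mul_le_mul ?_ v2 (avg_nonneg fun _ => sq_nonneg _) (by positivity)
    rw [← sq_abs]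
    exact pow_le_pow_left₀ (abs_nonneg _)
      ((Finset.abs_sum_le_sum_abs _ _).trans h.profile_le) 2
  refine le_trans (le_of_eq ?_) ((avg_sq_add_le e1 e2).trans (le_of_eq (by ring)))
  congr 1
  ext ε
  ring

end Concentration

/-! ### Forward and backward passes of a gated linear network -/

section Network

variable {din w b d : ℕ}

/-- The gated linear activation with gates `G`. -/
def gatedAct (G : ℕ → ℕ → ℕ → ℝ) (k m j : ℕ) (q : ℝ) : ℝ := q * G k m j

/-- The gates `g`, with the gate of the output layer open. -/
def openOutput (b d : ℕ) (g : ℕ → ℕ → ℕ → ℝ) (k m j : ℕ) : ℝ :=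
  if k = b + 1 ∧ m + 1 = d then 1 else g k m j

/-- The input of layer `(k, m)` in the gated linear network. -/
def fwd (Θ : Params din w b d) (G : ℕ → ℕ → ℕ → ℝ) (x : Fin din → ℝ) (k m : ℕ) : ℕ → ℝ :=
  runBlock Θ (gatedAct G) k (blockInput Θ (gatedAct G) x k) m

/-- Backward pass through the last `r` layers of block `k`, started at the covector `y`. -/
def bwdBlock (Θ : Params din w b d) (G : ℕ → ℕ → ℕ → ℝ) (k : ℕ) (y : ℕ → ℝ) : ℕ → ℕ → ℝ
  | 0 => y
  | r + 1 => fun i => ∑ j ∈ Finset.range (outDim w b d k (d - 1 - r)),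
      weight Θ k (d - 1 - r) i j * (G k (d - 1 - r) j * bwdBlock Θ G k y r j)

/-- The gradient of the output with respect to the input of block `b + 1 - r`. -/
def bwdIn (Θ : Params din w b d) (G : ℕ → ℕ → ℕ → ℝ) : ℕ → ℕ → ℝ
  | 0 => bwdBlock Θ G (b + 1) (fun _ => 1) d
  | r + 1 => fun i => bwdIn Θ G r i + bwdBlock Θ G (b - r) (bwdIn Θ G r) d i

/-- The gradient of the output with respect to the output of block `k`. -/
def bwdTop (Θ : Params din w b d) (G : ℕ → ℕ → ℕ → ℝ) (k : ℕ) : ℕ → ℝ :=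
  if k = b + 1 then fun _ => 1 else bwdIn Θ G (b - k)

/-- The gradient of the output with respect to the output of layer `(k, d - 1 - r)`. -/
def bwd (Θ : Params din w b d) (G : ℕ → ℕ → ℕ → ℝ) (k r : ℕ) : ℕ → ℝ :=
  bwdBlock Θ G k (bwdTop Θ G k) r

lemma weight_congr {Θ Θ' : Params din w b d} {k m : ℕ}
    (h : ∀ e : Weight din w b d, (e.1.1 : ℕ) = k → (e.1.2 : ℕ) = m → Θ e = Θ' e) :
    weight Θ k m = weight Θ' k m := by
  ext i j
  unfold weight
  split_ifs with hc
  · exact h _ rfl rfl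
  · rfl

lemma weight_eq_zero (Θ : Params din w b d) {k m j : ℕ} (i : ℕ) (hj : outDim w b d k m ≤ j) :
    weight Θ k m i j = 0 := dif_neg fun h => by omega

lemma linearLayer_eq_zero (Θ : Params din w b d) {k m j : ℕ} (z : ℕ → ℝ)
    (hj : outDim w b d k m ≤ j) : linearLayer Θ k m z j = 0 :=
  Finset.sum_eq_zero fun i _ => by rw [weight_eq_zero Θ i hj, zero_mul]

lemma runBlock_congr {Θ Θ' : Params din w b d} {G G' : ℕ → ℕ → ℕ → ℝ} {k : ℕ} (z : ℕ → ℝ)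
    {m : ℕ} (hΘ : ∀ m' < m, weight Θ k m' = weight Θ' k m')
    (hG : ∀ m' < m, ∀ j < outDim w b d k m', G k m' j = G' k m' j) :
    runBlock Θ (gatedAct G) k z m = runBlock Θ' (gatedAct G') k z m := by
  induction m with
  | zero => rfl
  | succ m ih =>
    ext j
    simp only [runBlock, gatedAct]
    rw [ih (fun m' hm' => hΘ m' (by omega)) fun m' hm' => hG m' (by omega)]
    by_cases hj : j < outDim w b d k m
    · rw [hG m (by omega) j hj]
      simp only [linearLayer, hΘ m (by omega)]
    · rw [linearLayer_eq_zero _ _ (by omega), linearLayer_eq_zero _ _ (by omega), zero_mul,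
        zero_mul]

lemma blockInput_congr {Θ Θ' : Params din w b d} {G G' : ℕ → ℕ → ℕ → ℝ} (x : Fin din → ℝ)
    {k : ℕ} (hΘ : ∀ k' < k, ∀ m < d, weight Θ k' m = weight Θ' k' m)
    (hG : ∀ k' < k, ∀ m < d, ∀ j < outDim w b d k' m, G k' m j = G' k' m j) :
    blockInput Θ (gatedAct G) x k = blockInput Θ' (gatedAct G') x k := by
  match k with
  | 0 => rfl
  | 1 => exact runBlock_congr _ (hΘ 0 (by omega)) (hG 0 (by omega))
  | k + 2 =>
    have ih := blockInput_congr x (k := k + 1) (fun k' hk' => hΘ k' (by omega))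
      (fun k' hk' => hG k' (by omega))
    ext j
    simp only [blockInput, ih]
    rw [runBlock_congr _ (hΘ (k + 1) (by omega)) (hG (k + 1) (by omega))]

lemma fwd_congr {Θ Θ' : Params din w b d} {G G' : ℕ → ℕ → ℕ → ℝ} (x : Fin din → ℝ) {k m : ℕ}
    (hΘ : ∀ k' m', (k' < k ∧ m' < d) ∨ (k' = k ∧ m' < m) → weight Θ k' m' = weight Θ' k' m')
    (hG : ∀ k' m', (k' < k ∧ m' < d) ∨ (k' = k ∧ m' < m) →
      ∀ j < outDim w b d k' m', G k' m' j = G' k' m' j) :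
    fwd Θ G x k m = fwd Θ' G' x k m := by
  unfold fwd
  rw [blockInput_congr x (fun k' hk' m' hm' => hΘ k' m' (Or.inl ⟨hk', hm'⟩))
    (fun k' hk' m' hm' => hG k' m' (Or.inl ⟨hk', hm'⟩))]
  exact runBlock_congr _ (fun m' hm' => hΘ k m' (Or.inr ⟨rfl, hm'⟩))
    (fun m' hm' => hG k m' (Or.inr ⟨rfl, hm'⟩))

lemma bwdBlock_congr {Θ Θ' : Params din w b d} (G : ℕ → ℕ → ℕ → ℝ) {k : ℕ} (y : ℕ → ℝ)
    {r : ℕ} (hr : r ≤ d) (hΘ : ∀ m, d - r ≤ m → m < d → weight Θ k m = weight Θ' k m) :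
    bwdBlock Θ G k y r = bwdBlock Θ' G k y r := by
  induction r with
  | zero => rfl
  | succ r ih =>
    ext i
    simp only [bwdBlock]
    rw [ih (by omega) fun m h1 h2 => hΘ m (by omega) h2, hΘ (d - 1 - r) (by omega) (by omega)]

lemma bwdIn_congr {Θ Θ' : Params din w b d} (G : ℕ → ℕ → ℕ → ℝ) {r : ℕ} (hr : r ≤ b)
    (hΘ : ∀ k, b + 1 - r ≤ k → ∀ m < d, weight Θ k m = weight Θ' k m) :
    bwdIn Θ G r = bwdIn Θ' G r := by
  induction r with
  | zero => exact bwdBlock_congr G _ le_rfl fun m _ hm => hΘ _ (by omega) m hm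
  | succ r ih =>
    ext i
    simp only [bwdIn]
    rw [ih (by omega) fun k hk => hΘ k (by omega),
      bwdBlock_congr G _ le_rfl fun m _ hm => hΘ (b - r) (by omega) m hm]

/-- The weights of the layers before `(k, m)`. -/
def before (din w b d k m : ℕ) : Set (Weight din w b d) :=
  {e | (e.1.1 : ℕ) < k ∨ ((e.1.1 : ℕ) = k ∧ (e.1.2 : ℕ) < m)}

/-- The weights of the layers after `(k, m)`. -/
def after (din w b d k m : ℕ) : Set (Weight din w b d) :=
  {e | k < (e.1.1 : ℕ) ∨ ((e.1.1 : ℕ) = k ∧ m < (e.1.2 : ℕ))}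

lemma disjoint_before_after (k m : ℕ) : Disjoint (before din w b d k m) (after din w b d k m) := by
  rw [Set.disjoint_left]
  intro e h1 h2
  simp only [before, after, Set.mem_ofPred_eq] at h1 h2
  omega

lemma dependsOn_fwd (G : ℕ → ℕ → ℕ → ℝ) (x : Fin din → ℝ) (k m : ℕ) :
    DependsOn (fun Θ : Params din w b d => fwd Θ G x k m) (before din w b d k m) := by
  intro Θ Θ' h
  refine fwd_congr x (fun k' m' hkm => weight_congr fun e h1 h2 => h e ?_)
    fun _ _ _ _ _ => rfl
  simp only [before, Set.mem_ofPred_eq]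
  omega

lemma dependsOn_bwd (G : ℕ → ℕ → ℕ → ℝ) {k m r : ℕ} (hk : k ≤ b + 1) (hr : r + m + 1 = d) :
    DependsOn (fun Θ : Params din w b d => bwd Θ G k r) (after din w b d k m) := by
  intro Θ Θ' h
  have h1 : bwdTop Θ G k = bwdTop Θ' G k := by
    unfold bwdTop
    split_ifs with hk'
    · rfl
    · refine bwdIn_congr G (by omega) fun k' hk' m' hm' => weight_congr fun e h1 h2 => h e ?_
      simp only [after, Set.mem_ofPred_eq]
      omega
  simp only [bwd, h1]
  refine bwdBlock_congr G _ (by omega) fun m' h1 h2 => weight_congr fun e h3 h4 => h e ?_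
  simp only [after, Set.mem_ofPred_eq]
  omega

lemma inDim_succ (k m : ℕ) : inDim din w k (m + 1) = w := by simp [inDim]

lemma inDim_of_pos {k : ℕ} (hk : 1 ≤ k) (m : ℕ) : inDim din w k m = w := by
  simp [inDim, Nat.ne_of_gt hk]

lemma outDim_of_lt {k m : ℕ} (h : m + 1 < d) : outDim w b d k m = w := by
  simp [outDim, h.ne]

lemma outDim_of_le {k : ℕ} (h : k ≤ b) (m : ℕ) : outDim w b d k m = w := by
  simp [outDim, show k ≠ b + 1 by omega]

lemma outDim_last (hd : 1 ≤ d) : outDim w b d (b + 1) (d - 1) = 1 := by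
  simp [outDim, Nat.sub_add_cancel hd]

/-- One step of the duality between the forward and the backward pass. -/
lemma bwdBlock_step (Θ : Params din w b d) (G : ℕ → ℕ → ℕ → ℝ) (k : ℕ) (y z : ℕ → ℝ)
    {r m : ℕ} (h : r + m + 1 = d) :
    ∑ j ∈ Finset.range (outDim w b d k m),
        bwdBlock Θ G k y r j * runBlock Θ (gatedAct G) k z (m + 1) j =
      ∑ i ∈ Finset.range (inDim din w k m),
        bwdBlock Θ G k y (r + 1) i * runBlock Θ (gatedAct G) k z m i := by
  have hm : d - 1 - r = m := by omega
  simp only [runBlock, bwdBlock, hm, gatedAct, linearLayer, Finset.mul_sum, Finset.sum_mul]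
  rw [Finset.sum_comm]
  refine Finset.sum_congr rfl fun i _ => Finset.sum_congr rfl fun j _ => ?_
  ring

lemma block_pairing (Θ : Params din w b d) (G : ℕ → ℕ → ℕ → ℝ) (k : ℕ) (y z : ℕ → ℝ)
    {r m : ℕ} (h : r + m + 1 = d) :
    ∑ j ∈ Finset.range (outDim w b d k (d - 1)), y j * runBlock Θ (gatedAct G) k z d j =
      ∑ j ∈ Finset.range (outDim w b d k m),
        bwdBlock Θ G k y r j * runBlock Θ (gatedAct G) k z (m + 1) j := by
  induction r generalizing m with
  | zero =>
    have hm : m + 1 = d := by omega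
    have hm' : d - 1 = m := by omega
    rw [hm', hm]
    rfl
  | succ r ih =>
    rw [ih (m := m + 1) (by omega), bwdBlock_step Θ G k y z (by omega), inDim_succ,
      outDim_of_lt (by omega)]

lemma block_pairing_input (hd : 1 ≤ d) (Θ : Params din w b d) (G : ℕ → ℕ → ℕ → ℝ) (k : ℕ)
    (y z : ℕ → ℝ) :
    ∑ j ∈ Finset.range (outDim w b d k (d - 1)), y j * runBlock Θ (gatedAct G) k z d j =
      ∑ i ∈ Finset.range (inDim din w k 0), bwdBlock Θ G k y d i * z i := by
  rw [block_pairing Θ G k y z (r := d - 1) (m := 0) (by omega),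
    bwdBlock_step Θ G k y z (by omega), Nat.sub_add_cancel hd]
  rfl

/-- The output of the network with gates `G`, the gates of the output layer included. -/
def gatedOutput (Θ : Params din w b d) (G : ℕ → ℕ → ℕ → ℝ) (x : Fin din → ℝ) : ℝ :=
  fwd Θ G x (b + 1) d 0

lemma netOutput_eq_gatedOutput (hd : 1 ≤ d) (Θ : Params din w b d) (g : ℕ → ℕ → ℕ → ℝ)
    (x : Fin din → ℝ) :
    netOutput Θ (fun k m j q => q * g k m j) x = gatedOutput Θ (openOutput b d g) x := by
  obtain ⟨n, rfl⟩ : ∃ n, d = n + 1 := ⟨d - 1, by omega⟩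
  have h1 : gatedOutput Θ (openOutput b (n + 1) g) x =
      linearLayer Θ (b + 1) n (fwd Θ (openOutput b (n + 1) g) x (b + 1) n) 0 * 1 := by
    simp [gatedOutput, fwd, runBlock, gatedAct, openOutput]
  have h2 : netOutput Θ (fun k m j q => q * g k m j) x =
      linearLayer Θ (b + 1) n (fwd Θ g x (b + 1) n) 0 := rfl
  rw [h1, h2, mul_one, fwd_congr x (fun _ _ _ => rfl)]
  intro k m hkm j _
  rw [openOutput, if_neg (by omega)]

lemma gatedOutput_eq_sum (hd : 1 ≤ d) (Θ : Params din w b d) (G : ℕ → ℕ → ℕ → ℝ)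
    (x : Fin din → ℝ) :
    gatedOutput Θ G x = ∑ j ∈ Finset.range (outDim w b d (b + 1) (d - 1)),
      (fun _ => (1 : ℝ)) j *
        runBlock Θ (gatedAct G) (b + 1) (blockInput Θ (gatedAct G) x (b + 1)) d j := by
  rw [outDim_last hd]
  simp [gatedOutput, fwd]

lemma gatedOutput_eq_bwdIn (hd : 1 ≤ d) (Θ : Params din w b d) (G : ℕ → ℕ → ℕ → ℝ)
    (x : Fin din → ℝ) {r : ℕ} (hr : r ≤ b) :
    gatedOutput Θ G x =
      ∑ i ∈ Finset.range w, bwdIn Θ G r i * blockInput Θ (gatedAct G) x (b + 1 - r) i := by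
  induction r with
  | zero =>
    rw [gatedOutput_eq_sum hd, block_pairing_input hd, inDim_of_pos (by omega)]
    rfl
  | succ r ih =>
    rw [ih (by omega)]
    obtain ⟨k, hk⟩ : ∃ k, b - r = k + 1 := ⟨b - r - 1, by omega⟩
    have h1 : b + 1 - r = k + 2 := by omega
    have h2 : b + 1 - (r + 1) = k + 1 := by omega
    have h3 := block_pairing_input hd Θ G (k + 1) (bwdIn Θ G r)
      (blockInput Θ (gatedAct G) x (k + 1))
    rw [outDim_of_le (by omega), inDim_of_pos (by omega)] at h3
    simp only [h1, h2, blockInput, bwdIn, hk, mul_add, add_mul, Finset.sum_add_distrib]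
    rw [h3]

/-- The part of the output that bypasses block `k`. -/
def bypass (Θ : Params din w b d) (G : ℕ → ℕ → ℕ → ℝ) (x : Fin din → ℝ) (k : ℕ) : ℝ :=
  if 1 ≤ k ∧ k ≤ b then
    ∑ i ∈ Finset.range w, bwdTop Θ G k i * blockInput Θ (gatedAct G) x k i else 0

lemma gatedOutput_eq_layer (Θ : Params din w b d) (G : ℕ → ℕ → ℕ → ℝ)
    (x : Fin din → ℝ) {k m r : ℕ} (hk : k ≤ b + 1) (hr : r + m + 1 = d) :
    gatedOutput Θ G x = bypass Θ G x k + ∑ j ∈ Finset.range (outDim w b d k m),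
      bwd Θ G k r j * (linearLayer Θ k m (fwd Θ G x k m) j * G k m j) := by
  have hd : 1 ≤ d := by omega
  have h := block_pairing Θ G k (bwdTop Θ G k) (blockInput Θ (gatedAct G) x k) hr
  change _ = ∑ j ∈ Finset.range (outDim w b d k m),
      bwd Θ G k r j * (linearLayer Θ k m (fwd Θ G x k m) j * G k m j) at h
  rw [← h]
  rcases Nat.lt_or_ge b k with hbk | hbk
  · obtain rfl : k = b + 1 := by omega
    rw [bypass, if_neg (by omega), zero_add, gatedOutput_eq_sum hd, bwdTop, if_pos rfl]
  · have ht : bwdTop Θ G k = bwdIn Θ G (b - k) := if_neg (by omega)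
    have hk' : b + 1 - (b - k) = k + 1 := by omega
    rw [gatedOutput_eq_bwdIn hd Θ G x (r := b - k) (by omega), hk', outDim_of_le hbk, bypass, ht]
    cases k with
    | zero => simp [blockInput]
    | succ k =>
      rw [if_pos ⟨by omega, hbk⟩]
      simp only [blockInput, mul_add, Finset.sum_add_distrib]

lemma bypass_congr {Θ Θ' : Params din w b d} (G : ℕ → ℕ → ℕ → ℝ) (x : Fin din → ℝ) {k : ℕ}
    (h : ∀ e : Weight din w b d, (e.1.1 : ℕ) ≠ k → Θ e = Θ' e) :
    bypass Θ G x k = bypass Θ' G x k := by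
  unfold bypass
  split_ifs with hk
  · have hw : ∀ k', k' ≠ k → ∀ m, weight Θ k' m = weight Θ' k' m := fun k' hk' m =>
      weight_congr fun e h1 _ => h e (by omega)
    have h1 : bwdTop Θ G k = bwdTop Θ' G k := by
      rw [bwdTop, bwdTop, if_neg (by omega), if_neg (by omega)]
      exact bwdIn_congr G (by omega) fun k' hk' m _ => hw k' (by omega) m
    rw [h1, blockInput_congr x (fun k' hk' m _ => hw k' (by omega) m) fun _ _ _ _ _ _ => rfl]
  · rfl

lemma weight_update (Θ : Params din w b d) (e : Weight din w b d) (t : ℝ) (i j : ℕ) :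
    weight (Function.update Θ e t) e.1.1 e.1.2 i j =
      if i = e.2.1 ∧ j = e.2.2 then t else weight Θ e.1.1 e.1.2 i j := by
  obtain ⟨⟨k, m⟩, ⟨i₀, j₀⟩⟩ := e
  unfold weight
  by_cases h : ((k : ℕ) < b + 2 ∧ (m : ℕ) < d) ∧ i < inDim din w k m ∧ j < outDim w b d k m
  · simp only [dif_pos h]
    split_ifs with hij
    · obtain ⟨rfl, rfl⟩ := hij
      simp
    · rw [Function.update_of_ne]
      intro heq
      simp only [Fin.eta, Sigma.mk.injEq, heq_eq_eq, Prod.mk.injEq, true_and] at heq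
      exact hij ⟨by rw [← heq.1], by rw [← heq.2]⟩
  · rw [dif_neg h, if_neg]
    · simp only [dif_neg h]
    · rintro ⟨rfl, rfl⟩
      exact h ⟨⟨k.2, m.2⟩, i₀.2, j₀.2⟩

lemma hasDerivAt_gatedOutput (Θ : Params din w b d) (G : ℕ → ℕ → ℕ → ℝ) (x : Fin din → ℝ)
    (e : Weight din w b d) :
    HasDerivAt (fun t => gatedOutput (Function.update Θ e t) G x)
      (fwd Θ G x e.1.1 e.1.2 e.2.1 *
        (G e.1.1 e.1.2 e.2.2 * bwd Θ G e.1.1 (d - 1 - e.1.2) e.2.2)) (Θ e) := by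
  have hm := e.1.2.2
  have hk : (e.1.1 : ℕ) ≤ b + 1 := by omega
  have hr : d - 1 - (e.1.2 : ℕ) + e.1.2 + 1 = d := by omega
  have hne : ∀ t, ∀ a : Weight din w b d, a ≠ e → Function.update Θ e t a = Θ a := fun t a ha =>
    Function.update_of_ne ha _ _
  have heq : ∀ t, gatedOutput (Function.update Θ e t) G x = bypass Θ G x e.1.1 +
      ∑ j ∈ Finset.range (outDim w b d e.1.1 e.1.2), ∑ i ∈ Finset.range (inDim din w e.1.1 e.1.2),
        (if i = e.2.1 ∧ j = e.2.2 then t else weight Θ e.1.1 e.1.2 i j) *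
          (fwd Θ G x e.1.1 e.1.2 i * (G e.1.1 e.1.2 j * bwd Θ G e.1.1 (d - 1 - e.1.2) j)) := by
    intro t
    have h1 : fwd (Function.update Θ e t) G x e.1.1 e.1.2 = fwd Θ G x e.1.1 e.1.2 :=
      dependsOn_fwd G x _ _ fun a ha => hne t a (by
        rintro rfl
        simp [before] at ha)
    have h2 : bwd (Function.update Θ e t) G e.1.1 (d - 1 - e.1.2) =
        bwd Θ G e.1.1 (d - 1 - e.1.2) :=
      dependsOn_bwd G hk hr fun a ha => hne t a (by
        rintro rfl
        simp [after] at ha)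
    have h3 : bypass (Function.update Θ e t) G x e.1.1 = bypass Θ G x e.1.1 :=
      bypass_congr G x fun a ha => hne t a (by
        rintro rfl
        exact ha rfl)
    rw [gatedOutput_eq_layer (Function.update Θ e t) G x hk hr, h1, h2, h3]
    congr 1
    refine Finset.sum_congr rfl fun j _ => ?_
    rw [linearLayer, Finset.sum_mul, Finset.mul_sum]
    refine Finset.sum_congr rfl fun i _ => ?_
    rw [weight_update]
    ring
  simp only [heq]
  have hval : fwd Θ G x e.1.1 e.1.2 e.2.1 *
        (G e.1.1 e.1.2 e.2.2 * bwd Θ G e.1.1 (d - 1 - e.1.2) e.2.2) =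
      ∑ j ∈ Finset.range (outDim w b d e.1.1 e.1.2), ∑ i ∈ Finset.range (inDim din w e.1.1 e.1.2),
        (if i = e.2.1 ∧ j = e.2.2 then 1 else 0) *
          (fwd Θ G x e.1.1 e.1.2 i * (G e.1.1 e.1.2 j * bwd Θ G e.1.1 (d - 1 - e.1.2) j)) := by
    rw [Finset.sum_eq_single_of_mem (e.2.2 : ℕ) (Finset.mem_range.2 e.2.2.2),
      Finset.sum_eq_single_of_mem (e.2.1 : ℕ) (Finset.mem_range.2 e.2.1.2)]
    · simp
    · intro i _ hi
      simp [hi]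
    · intro j _ hj
      simp [hj]
  rw [hval]
  refine HasDerivAt.const_add _ (HasDerivAt.fun_sum fun j _ => HasDerivAt.fun_sum fun i _ => ?_)
  refine HasDerivAt.mul_const ?_ _
  split_ifs
  · exact hasDerivAt_id _
  · exact hasDerivAt_const _ _

lemma partialWeight_eq (hd : 1 ≤ d) (Θf Θv : Params din w b d) (x : Fin din → ℝ)
    (e : Weight din w b d) :
    partialWeight Θf Θv x e = fwd Θv (openOutput b d (gate Θf x)) x e.1.1 e.1.2 e.2.1 *
      (openOutput b d (gate Θf x) e.1.1 e.1.2 e.2.2 *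
        bwd Θv (openOutput b d (gate Θf x)) e.1.1 (d - 1 - e.1.2) e.2.2) := by
  unfold partialWeight dgnOutput
  simp only [netOutput_eq_gatedOutput hd]
  exact (hasDerivAt_gatedOutput Θv _ x e).deriv

/-- The derivative of a function with finitely many values vanishes. -/
lemma deriv_eq_zero_of_finite_range {f : ℝ → ℝ} (hf : (Set.range f).Finite) (t : ℝ) :
    deriv f t = 0 := by
  by_cases h : DifferentiableAt ℝ f t
  · have h1 : ∀ᶠ u in 𝓝 t, f u ∉ Set.range f \ {f t} :=
      h.continuousAt.eventually_mem
        ((hf.subset Set.sdiff_subset).isClosed.isOpen_compl.mem_nhds (by simp))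
    have h2 : f =ᶠ[𝓝 t] fun _ => f t := by
      filter_upwards [h1] with u hu
      by_contra hne
      exact hu ⟨⟨u, rfl⟩, hne⟩
    rw [h2.deriv_eq, deriv_const]
  · exact deriv_zero_of_not_differentiableAt h

lemma step_eq_zero_or_one (q : ℝ) : step q = 0 ∨ step q = 1 := by
  unfold step
  split_ifs <;> simp

lemma partialGating_eq_zero (hd : 1 ≤ d) (Θf Θv : Params din w b d) (x : Fin din → ℝ)
    (e : Weight din w b d) : partialGating Θf Θv x e = 0 := by
  classical
  refine deriv_eq_zero_of_finite_range ?_ _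
  let pat : (ℕ → ℕ → ℕ → ℝ) → (Fin (b + 2) × Fin (d + 1) × Fin (w + 1)) → Bool :=
    fun g p => decide (g p.1 p.2.1 p.2.2 = 1)
  let Φ : ((Fin (b + 2) × Fin (d + 1) × Fin (w + 1)) → Bool) → ℝ := fun B =>
    netOutput Θv (fun k m j q => q * (if h : k < b + 2 ∧ m < d + 1 ∧ j < w + 1 then
      (if B (⟨k, h.1⟩, ⟨m, h.2.1⟩, ⟨j, h.2.2⟩) then 1 else 0) else 0)) x
  refine (Set.finite_range Φ).subset ?_
  rintro _ ⟨t, rfl⟩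
  refine ⟨pat (gate (Function.update Θf e t) x), ?_⟩
  simp only [Φ, dgnOutput, netOutput_eq_gatedOutput hd, gatedOutput]
  refine congrFun (fwd_congr x (fun _ _ _ => rfl) fun k m hkm j hj => ?_) 0
  unfold openOutput
  split_ifs with h1
  · rfl
  · rw [outDim, if_neg h1] at hj
    beta_reduce
    rw [dif_pos ⟨by omega, by omega, by omega⟩]
    simp only [pat, gate]
    rcases step_eq_zero_or_one (preAct (Function.update Θf e t) relu x k m j) with h | h <;>
      simp [h]

/-- Inner product of the inputs of layer `(k, m)` for two inputs of the network. -/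
def fwdInner (Θ : Params din w b d) (G G' : ℕ → ℕ → ℕ → ℝ) (x x' : Fin din → ℝ) (k m : ℕ) : ℝ :=
  ∑ i : Fin (inDim din w k m), fwd Θ G x k m i * fwd Θ G' x' k m i

/-- Inner product of the gated gradients at layer `(k, m)` for two inputs of the network. -/
def bwdInner (Θ : Params din w b d) (G G' : ℕ → ℕ → ℕ → ℝ) (k m : ℕ) : ℝ :=
  ∑ j : Fin (outDim w b d k m), G k m j * bwd Θ G k (d - 1 - m) j *
    (G' k m j * bwd Θ G' k (d - 1 - m) j)

lemma ntk_eq (hd : 1 ≤ d) (Θf Θv : Params din w b d) (x x' : Fin din → ℝ) :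
    ntk Θf Θv x x' = ∑ l : Fin (b + 2) × Fin d,
      fwdInner Θv (openOutput b d (gate Θf x)) (openOutput b d (gate Θf x')) x x' l.1 l.2 *
        bwdInner Θv (openOutput b d (gate Θf x)) (openOutput b d (gate Θf x')) l.1 l.2 := by
  unfold ntk
  simp only [partialGating_eq_zero hd, partialWeight_eq hd, mul_zero, Finset.sum_const_zero,
    zero_add]
  rw [Fintype.sum_sigma]
  refine Finset.sum_congr rfl fun l _ => ?_
  rw [Fintype.sum_prod_type, fwdInner, bwdInner, Finset.sum_mul_sum]
  refine Finset.sum_congr rfl fun i _ => Finset.sum_congr rfl fun j _ => ?_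
  ring

end Network

/-! ### Concentration for the random gated network -/

section NetworkConcentration

variable {din w b d : ℕ} {c σ : ℝ} {G G' : ℕ → ℕ → ℕ → ℝ}

/-- The parameters `σ ε` given by a sign pattern `ε`. -/
def signParams (σ : ℝ) (ε : Weight din w b d → ℤˣ) : Params din w b d := fun e => σ * sgn (ε e)

/-- Weights of size `σ = c / √w` and gates bounded by `1`. -/
structure Regime (c σ : ℝ) (w : ℕ) (G G' : ℕ → ℕ → ℕ → ℝ) : Prop where
  one_le : 1 ≤ (w : ℝ)
  scale : σ ^ 2 * w = c ^ 2
  abs_gate_le : ∀ k m j, |G k m j| ≤ 1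
  abs_gate_le' : ∀ k m j, |G' k m j| ≤ 1

lemma dependsOn_signParams {β : Type*} {F : Params din w b d → β} {S : Set (Weight din w b d)}
    (hF : DependsOn F S) (σ : ℝ) : DependsOn (fun ε => F (signParams σ ε)) S :=
  fun ε ε' h => hF fun e he => by rw [signParams, signParams, h e he]

/-- Concentration of the first `n` coordinates. -/
abbrev ConcentratedUpTo (n : ℕ) (w : ℕ) (y y' : (Weight din w b d → ℤˣ) → ℕ → ℝ) (s : ℕ → ℝ)
    (K : ℝ) : Prop :=
  Concentrated (w : ℝ) (fun ε (i : Fin n) => y ε i) (fun ε (i : Fin n) => y' ε i)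
    (fun i : Fin n => s i) K

lemma dependsOn_restrict {y : (Weight din w b d → ℤˣ) → ℕ → ℝ} {S : Set (Weight din w b d)}
    (h : DependsOn y S) (n : ℕ) : DependsOn (fun ε (i : Fin n) => y ε i) S :=
  fun ε ε' hε => by
    ext i
    exact congrFun (h hε) i

/-- The weights of layer `(k, m)`. -/
def layerEmb {k m : ℕ} (hk : k < b + 2) (hm : m < d) :
    Fin (inDim din w k m) × Fin (outDim w b d k m) ↪ Weight din w b d where
  toFun p := ⟨(⟨k, hk⟩, ⟨m, hm⟩), p⟩
  inj' p q h := by simpa using h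

/-- The weights of layer `(k, m)`, for the backward pass. -/
def layerEmbSwap {k m : ℕ} (hk : k < b + 2) (hm : m < d) :
    Fin (outDim w b d k m) × Fin (inDim din w k m) ↪ Weight din w b d :=
  (Equiv.prodComm _ _).toEmbedding.trans (layerEmb hk hm)

lemma weight_signParams {k m : ℕ} (hk : k < b + 2) (hm : m < d)
    (ε : Weight din w b d → ℤˣ) (i : Fin (inDim din w k m)) (j : Fin (outDim w b d k m)) :
    weight (signParams σ ε) k m i j = σ * sgn (ε (layerEmb hk hm (i, j))) := by
  rw [weight, dif_pos ⟨⟨hk, hm⟩, i.2, j.2⟩]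
  rfl

lemma linearLayer_signParams {k m : ℕ} (hk : k < b + 2) (hm : m < d)
    (y : (Weight din w b d → ℤˣ) → ℕ → ℝ) (ε : Weight din w b d → ℤˣ)
    (j : Fin (outDim w b d k m)) :
    linearLayer (signParams σ ε) k m (y ε) j =
      signLayer σ (layerEmb hk hm) (fun ε (i : Fin (inDim din w k m)) => y ε i) ε j := by
  rw [linearLayer, Finset.sum_range, signLayer]
  exact Finset.sum_congr rfl fun i _ => by rw [weight_signParams hk hm]

lemma backLayer_signParams {k m : ℕ} (hk : k < b + 2) (hm : m < d)
    (y : (Weight din w b d → ℤˣ) → ℕ → ℝ) (ε : Weight din w b d → ℤˣ)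
    (i : Fin (inDim din w k m)) :
    ∑ j ∈ Finset.range (outDim w b d k m), weight (signParams σ ε) k m i j * y ε j =
      signLayer σ (layerEmbSwap hk hm) (fun ε (j : Fin (outDim w b d k m)) => y ε j) ε i := by
  rw [Finset.sum_range, signLayer]
  exact Finset.sum_congr rfl fun j _ => by rw [weight_signParams hk hm]; rfl

lemma avoidsLayer_before {k m : ℕ} (hk : k < b + 2) (hm : m < d) :
    AvoidsLayer (layerEmb (din := din) (w := w) hk hm) (before din w b d k m) := by
  intro p hp
  have : k < k ∨ (k = k ∧ m < m) := hp
  omega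

lemma avoidsLayer_after {k m : ℕ} (hk : k < b + 2) (hm : m < d) :
    AvoidsLayer (layerEmbSwap (din := din) (w := w) hk hm) (after din w b d k m) := by
  intro p hp
  have : k < k ∨ (k = k ∧ m < m) := hp
  omega

/-- The factor by which one layer increases the constants. -/
def growth (c : ℝ) : ℝ := 1 + (6 * c ^ 4 + c ^ 2)

lemma one_le_growth (c : ℝ) : 1 ≤ growth c := by
  unfold growth
  have : 0 ≤ 6 * c ^ 4 + c ^ 2 := by positivity
  linarith

lemma Regime.pos (h : Regime c σ w G G') : 0 < (w : ℝ) := by linarith [h.one_le]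

lemma outDim_le (h : 1 ≤ (w : ℝ)) (k m : ℕ) : (outDim w b d k m : ℝ) ≤ w := by
  unfold outDim
  split_ifs
  · exact_mod_cast h
  · rfl

variable {y y' : (Weight din w b d → ℤˣ) → ℕ → ℝ} {s : ℕ → ℝ} {K : ℝ}

lemma concentrated_forward_step (h : Regime c σ w G G') {k m : ℕ} (hk : k < b + 2) (hm : m < d)
    (hy : DependsOn y (before din w b d k m)) (hy' : DependsOn y' (before din w b d k m))
    (hc : ConcentratedUpTo (inDim din w k m) w y y' s K) :
    ConcentratedUpTo (outDim w b d k m) w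
      (fun ε j => linearLayer (signParams σ ε) k m (y ε) j * G k m j)
      (fun ε j => linearLayer (signParams σ ε) k m (y' ε) j * G' k m j)
      (fun j => G k m j * G' k m j * (σ ^ 2 * ∑ i ∈ Finset.range (inDim din w k m), s i))
      (growth c * K) := by
  have h1 := ((hc.linear (κ := Fin (outDim w b d k m)) h.one_le h.scale
    (by rw [Fintype.card_fin]; exact outDim_le h.one_le k m)
    (avoidsLayer_before hk hm) (dependsOn_restrict hy _) (dependsOn_restrict hy' _)).mask
    (a := fun j => G k m j) (a' := fun j => G' k m j) (fun _ => h.abs_gate_le _ _ _)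
    (fun _ => h.abs_gate_le' _ _ _)).mono h.pos (K' := growth c * K) (by
      have := hc.nonneg
      unfold growth; linarith)
  unfold ConcentratedUpTo
  simp only [linearLayer_signParams hk hm, mul_comm (signLayer _ _ _ _ _)]
  convert h1 using 3
  all_goals first | rfl | rw [Finset.sum_range]

lemma concentrated_forward_skip (h : Regime c σ w G G') {k m : ℕ} (hk : k < b + 2) (hm : m < d)
    (hy : DependsOn y (before din w b d k m)) (hy' : DependsOn y' (before din w b d k m))
    (hc : ConcentratedUpTo (inDim din w k m) w y y' s K)
    {z z' : (Weight din w b d → ℤˣ) → ℕ → ℝ} {sz : ℕ → ℝ}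
    (hz : DependsOn z (before din w b d k m)) (hz' : DependsOn z' (before din w b d k m))
    (hcz : ConcentratedUpTo (outDim w b d k m) w z z' sz K) :
    ConcentratedUpTo (outDim w b d k m) w
      (fun ε j => z ε j + linearLayer (signParams σ ε) k m (y ε) j * G k m j)
      (fun ε j => z' ε j + linearLayer (signParams σ ε) k m (y' ε) j * G' k m j)
      (fun j => sz j +
        G k m j * G' k m j * (σ ^ 2 * ∑ i ∈ Finset.range (inDim din w k m), s i))
      (16 * growth c * K) := by
  have h1 := hc.add_layer (κ := Fin (outDim w b d k m)) h.one_le h.scale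
    (by rw [Fintype.card_fin]; exact outDim_le h.one_le k m)
    (avoidsLayer_before hk hm) (dependsOn_restrict hy _) (dependsOn_restrict hy' _)
    (a := fun j => G k m j) (a' := fun j => G' k m j) (fun _ => h.abs_gate_le _ _ _)
    (fun _ => h.abs_gate_le' _ _ _) (dependsOn_restrict hz _) (dependsOn_restrict hz' _) hcz
  unfold ConcentratedUpTo
  simp only [linearLayer_signParams hk hm, mul_comm (signLayer _ _ _ _ _)]
  convert h1 using 3
  all_goals first | rfl | rw [Finset.sum_range]

lemma concentrated_gated (h : Regime c σ w G G') {k m : ℕ}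
    (hc : ConcentratedUpTo (outDim w b d k m) w y y' s K) :
    ConcentratedUpTo (outDim w b d k m) w (fun ε j => G k m j * y ε j)
      (fun ε j => G' k m j * y' ε j) (fun j => G k m j * G' k m j * s j) K :=
  hc.mask (a := fun j => G k m j) (a' := fun j => G' k m j) (fun _ => h.abs_gate_le _ _ _)
    (fun _ => h.abs_gate_le' _ _ _)

lemma concentrated_backward_step (h : Regime c σ w G G') {k m : ℕ} (hk : k < b + 2) (hm : m < d)
    (hin : inDim din w k m = w)
    (hy : DependsOn y (after din w b d k m)) (hy' : DependsOn y' (after din w b d k m))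
    (hc : ConcentratedUpTo (outDim w b d k m) w y y' s K) :
    ConcentratedUpTo w w
      (fun ε i => ∑ j ∈ Finset.range (outDim w b d k m),
        weight (signParams σ ε) k m i j * (G k m j * y ε j))
      (fun ε i => ∑ j ∈ Finset.range (outDim w b d k m),
        weight (signParams σ ε) k m i j * (G' k m j * y' ε j))
      (fun _ => σ ^ 2 * ∑ j ∈ Finset.range (outDim w b d k m), G k m j * G' k m j * s j)
      (growth c * K) := by
  have hd : ∀ {y : (Weight din w b d → ℤˣ) → ℕ → ℝ} (G : ℕ → ℕ → ℕ → ℝ),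
      DependsOn y (after din w b d k m) →
      DependsOn (fun ε j => G k m j * y ε j) (after din w b d k m) := by
    intro y G hy x x' hx
    simp only [hy hx]
  have h1 := ((concentrated_gated h hc).linear (κ := Fin (inDim din w k m)) h.one_le h.scale
    (by rw [Fintype.card_fin, hin]) (avoidsLayer_after hk hm) (dependsOn_restrict (hd G hy) _)
    (dependsOn_restrict (hd G' hy') _)).mono h.pos (K' := growth c * K) (by
      have := hc.nonneg
      unfold growth; linarith)
  have h2 : ConcentratedUpTo (inDim din w k m) w
      (fun ε i => ∑ j ∈ Finset.range (outDim w b d k m),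
        weight (signParams σ ε) k m i j * (G k m j * y ε j))
      (fun ε i => ∑ j ∈ Finset.range (outDim w b d k m),
        weight (signParams σ ε) k m i j * (G' k m j * y' ε j))
      (fun _ => σ ^ 2 * ∑ j ∈ Finset.range (outDim w b d k m), G k m j * G' k m j * s j)
      (growth c * K) := by
    unfold ConcentratedUpTo
    simp only [backLayer_signParams hk hm (fun ε j => G k m j * y ε j),
      backLayer_signParams hk hm (fun ε j => G' k m j * y' ε j)]
    convert h1 using 3
    rw [Finset.sum_range]
  rwa [hin] at h2

lemma concentrated_backward_skip (h : Regime c σ w G G') {k m : ℕ} (hk : k < b + 2) (hm : m < d)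
    (hin : inDim din w k m = w)
    (hy : DependsOn y (after din w b d k m)) (hy' : DependsOn y' (after din w b d k m))
    (hc : ConcentratedUpTo (outDim w b d k m) w y y' s K)
    {z z' : (Weight din w b d → ℤˣ) → ℕ → ℝ} {sz : ℕ → ℝ}
    (hz : DependsOn z (after din w b d k m)) (hz' : DependsOn z' (after din w b d k m))
    (hcz : ConcentratedUpTo w w z z' sz K) :
    ConcentratedUpTo w w
      (fun ε i => z ε i + ∑ j ∈ Finset.range (outDim w b d k m),
        weight (signParams σ ε) k m i j * (G k m j * y ε j))
      (fun ε i => z' ε i + ∑ j ∈ Finset.range (outDim w b d k m),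
        weight (signParams σ ε) k m i j * (G' k m j * y' ε j))
      (fun i => sz i +
        σ ^ 2 * ∑ j ∈ Finset.range (outDim w b d k m), G k m j * G' k m j * s j)
      (16 * growth c * K) := by
  have hd : ∀ {y : (Weight din w b d → ℤˣ) → ℕ → ℝ} (G : ℕ → ℕ → ℕ → ℝ),
      DependsOn y (after din w b d k m) →
      DependsOn (fun ε j => G k m j * y ε j) (after din w b d k m) := by
    intro y G hy x x' hx
    simp only [hy hx]
  have hcz' : ConcentratedUpTo (inDim din w k m) w z z' sz K := by rwa [hin]
  have h1 := (concentrated_gated h hc).add_layer (κ := Fin (inDim din w k m)) h.one_le h.scale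
    (by rw [Fintype.card_fin, hin]) (avoidsLayer_after hk hm) (dependsOn_restrict (hd G hy) _)
    (dependsOn_restrict (hd G' hy') _) (a := fun _ => 1) (a' := fun _ => 1) (fun _ => by simp)
    (fun _ => by simp) (dependsOn_restrict hz _) (dependsOn_restrict hz' _) hcz'
  have h2 : ConcentratedUpTo (inDim din w k m) w
      (fun ε i => z ε i + ∑ j ∈ Finset.range (outDim w b d k m),
        weight (signParams σ ε) k m i j * (G k m j * y ε j))
      (fun ε i => z' ε i + ∑ j ∈ Finset.range (outDim w b d k m),
        weight (signParams σ ε) k m i j * (G' k m j * y' ε j))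
      (fun i => sz i +
        σ ^ 2 * ∑ j ∈ Finset.range (outDim w b d k m), G k m j * G' k m j * s j)
      (16 * growth c * K) := by
    unfold ConcentratedUpTo
    simp only [backLayer_signParams hk hm (fun ε j => G k m j * y ε j),
      backLayer_signParams hk hm (fun ε j => G' k m j * y' ε j)]
    simp only [one_mul] at h1
    convert h1 using 3
    all_goals first | rfl | rw [Finset.sum_range]
  rwa [hin] at h2

/-- The number of nodes of layer `(k, m)` at which both gates are open. -/
def overlap (w b d : ℕ) (G G' : ℕ → ℕ → ℕ → ℝ) (k m : ℕ) : ℝ :=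
  ∑ j ∈ Finset.range (outDim w b d k m), G k m j * G' k m j

/-- The factor by which block `k` multiplies inner products on average. -/
def blockGain (w b d : ℕ) (σ : ℝ) (G G' : ℕ → ℕ → ℕ → ℝ) (k : ℕ) : ℝ :=
  ∏ m ∈ Finset.range d, (σ ^ 2 * overlap w b d G G' k m)

/-- The mean of the inner product of the inputs of block `k`, relative to that of the inputs. -/
def inputGain (w b d : ℕ) (σ : ℝ) (G G' : ℕ → ℕ → ℕ → ℝ) : ℕ → ℝ
  | 0 => 1
  | 1 => blockGain w b d σ G G' 0
  | k + 2 => inputGain w b d σ G G' (k + 1) * (1 + blockGain w b d σ G G' (k + 1))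

/-- The mean of the product of the gradients at a node of the input of block `b + 1 - r`. -/
def gradGain (w b d : ℕ) (σ : ℝ) (G G' : ℕ → ℕ → ℕ → ℝ) : ℕ → ℝ
  | 0 => blockGain w b d σ G G' (b + 1)
  | r + 1 => gradGain w b d σ G G' r * (1 + blockGain w b d σ G G' (b - r))

/-- The constant of the concentration bound for the network inputs. -/
def inputBound (x x' : Fin din → ℝ) : ℝ :=
  (∑ i, x i ^ 2) ^ 2 + (∑ i, x' i ^ 2) ^ 2 + ∑ i, |x i * x' i|

lemma sum_fin_inDim_zero (f : ℕ → ℝ) :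
    ∑ i : Fin (inDim din w 0 0), f i = ∑ i : Fin din, f i := by
  rw [Fin.sum_univ_eq_sum_range, Fin.sum_univ_eq_sum_range]
  simp [inDim]

lemma inputVec_fin (x : Fin din → ℝ) (i : Fin din) : inputVec x i = x i := by
  rw [inputVec, dif_pos i.2]

lemma concentrated_input (hw : 0 < (w : ℝ)) (x x' : Fin din → ℝ) :
    ConcentratedUpTo (din := din) (b := b) (d := d) (inDim din w 0 0) w
      (fun _ => inputVec x) (fun _ => inputVec x')
      (fun i => inputVec x i * inputVec x' i) (inputBound x x') := by
  have h3 : 0 ≤ ∑ i, |x i * x' i| := Finset.sum_nonneg fun _ _ => abs_nonneg _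
  have h4 : 0 ≤ inputBound x x' := by unfold inputBound; positivity
  refine ⟨?_, ?_, ?_, ?_⟩
  · rw [avg_const, sum_fin_inDim_zero fun i => inputVec x i ^ 2]
    simp only [inputVec_fin]
    unfold inputBound
    linarith [sq_nonneg (∑ i, x' i ^ 2)]
  · rw [avg_const, sum_fin_inDim_zero fun i => inputVec x' i ^ 2]
    simp only [inputVec_fin]
    unfold inputBound
    linarith [sq_nonneg (∑ i, x i ^ 2)]
  · rw [sum_fin_inDim_zero fun i => |inputVec x i * inputVec x' i|]
    simp only [inputVec_fin]
    unfold inputBound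
    linarith [sq_nonneg (∑ i, x i ^ 2), sq_nonneg (∑ i, x' i ^ 2)]
  · intro h _
    simp only [sub_self, mul_zero, Finset.sum_const_zero]
    rw [avg_const, sq, mul_zero]
    exact div_nonneg h4 hw.le

lemma dependsOn_fwd_sign (σ : ℝ) (G : ℕ → ℕ → ℕ → ℝ) (x : Fin din → ℝ) (k m : ℕ) :
    DependsOn (fun ε : Weight din w b d → ℤˣ => fwd (signParams σ ε) G x k m)
      (before din w b d k m) :=
  dependsOn_signParams (dependsOn_fwd G x k m) σ

lemma concentrated_fwd_block (h : Regime c σ w G G') (x x' : Fin din → ℝ) {k : ℕ}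
    (hk : k < b + 2) {S : ℝ} {s : ℕ → ℝ}
    (hs : ∑ i ∈ Finset.range (inDim din w k 0), s i = S)
    (hc : ConcentratedUpTo (din := din) (b := b) (d := d) (inDim din w k 0) w
      (fun ε => fwd (signParams σ ε) G x k 0) (fun ε => fwd (signParams σ ε) G' x' k 0) s K)
    {m : ℕ} (hm : m < d) :
    ∃ s : ℕ → ℝ, ∑ i ∈ Finset.range (inDim din w k m), s i =
        S * ∏ m' ∈ Finset.range m, (σ ^ 2 * overlap w b d G G' k m') ∧
      ConcentratedUpTo (din := din) (b := b) (d := d) (inDim din w k m) w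
        (fun ε => fwd (signParams σ ε) G x k m) (fun ε => fwd (signParams σ ε) G' x' k m) s
        (growth c ^ m * K) := by
  induction m with
  | zero => exact ⟨s, by simpa using hs, by simpa using hc⟩
  | succ m ih =>
    obtain ⟨s, hs, hc⟩ := ih (by omega)
    have h1 := concentrated_forward_step h hk (by omega) (dependsOn_fwd_sign σ G x k m)
      (dependsOn_fwd_sign σ G' x' k m) hc
    have hdim : outDim w b d k m = inDim din w k (m + 1) := by
      rw [outDim_of_lt hm, inDim_succ]
    refine ⟨fun j => G k m j * G' k m j *
      (σ ^ 2 * ∑ i ∈ Finset.range (inDim din w k m), s i), ?_, ?_⟩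
    rotate_left
    · rw [hdim] at h1
      rw [pow_succ' (growth c), mul_assoc]
      exact h1
    · rw [← Finset.sum_mul, Finset.prod_range_succ, hs, ← hdim, overlap]
      ring

lemma blockGain_eq {n : ℕ} (k : ℕ) : blockGain w b (n + 1) σ G G' k =
    (∏ m ∈ Finset.range n, (σ ^ 2 * overlap w b (n + 1) G G' k m)) *
      (σ ^ 2 * overlap w b (n + 1) G G' k n) := Finset.prod_range_succ _ _

/-- Inner products of forward vectors concentrate. -/
lemma concentrated_fwd_zero (h : Regime c σ w G G') (x x' : Fin din → ℝ) (hd : 1 ≤ d) {k : ℕ}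
    (hk : k < b + 2) :
    ∃ s : ℕ → ℝ, ∑ i ∈ Finset.range (inDim din w k 0), s i =
        (∑ i, x i * x' i) * inputGain w b d σ G G' k ∧
      ConcentratedUpTo (din := din) (b := b) (d := d) (inDim din w k 0) w
        (fun ε => fwd (signParams σ ε) G x k 0) (fun ε => fwd (signParams σ ε) G' x' k 0) s
        ((16 * growth c ^ d) ^ k * inputBound x x') := by
  obtain ⟨n, rfl⟩ : ∃ n, d = n + 1 := ⟨d - 1, by omega⟩
  have hg := one_le_growth c
  induction k with
  | zero =>
    refine ⟨fun i => inputVec x i * inputVec x' i, ?_, ?_⟩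
    · rw [← Fin.sum_univ_eq_sum_range, sum_fin_inDim_zero fun i => inputVec x i * inputVec x' i]
      simp [inputVec_fin, inputGain]
    · rw [pow_zero, one_mul]
      exact concentrated_input h.pos x x'
  | succ k ih =>
    obtain ⟨s, hs, hc⟩ := ih (by omega)
    cases k with
    | zero =>
      obtain ⟨s, hs, hc⟩ := concentrated_fwd_block h x x' (by omega) hs hc (m := n) (by omega)
      have h1 := concentrated_forward_step h (by omega) (by omega) (dependsOn_fwd_sign σ G x 0 n)
        (dependsOn_fwd_sign σ G' x' 0 n) hc
      have hdim : outDim w b (n + 1) 0 n = inDim din w 1 0 := by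
        rw [outDim_of_le (by omega), inDim_of_pos le_rfl]
      refine ⟨fun j => G 0 n j * G' 0 n j *
        (σ ^ 2 * ∑ i ∈ Finset.range (inDim din w 0 n), s i), ?_, ?_⟩
      rotate_left
      · rw [hdim] at h1
        refine h1.mono h.pos ?_
        have : 0 ≤ growth c ^ (n + 1) * inputBound x x' :=
          mul_nonneg (by positivity) (concentrated_input (b := b) (d := n + 1) h.pos x x').nonneg
        rw [pow_zero, one_mul, ← mul_assoc, ← pow_succ', pow_one]
        linarith
      · rw [← Finset.sum_mul, hs, ← hdim, inputGain, inputGain, blockGain_eq, overlap]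
        ring
    | succ k =>
      obtain ⟨s', hs', hc'⟩ := concentrated_fwd_block h x x' (by omega) hs hc (m := n) (by omega)
      have hdim : outDim w b (n + 1) (k + 1) n = inDim din w (k + 2) 0 := by
        rw [outDim_of_le (by omega), inDim_of_pos (by omega)]
      have hdim' : outDim w b (n + 1) (k + 1) n = inDim din w (k + 1) 0 := by
        rw [outDim_of_le (by omega), inDim_of_pos (by omega)]
      have hsub : before din w b (n + 1) (k + 1) 0 ⊆ before din w b (n + 1) (k + 1) n := by
        intro e he
        simp only [before, Set.mem_ofPred_eq] at he ⊢
        omega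
      have hcz : ConcentratedUpTo (din := din) (b := b) (d := n + 1)
          (outDim w b (n + 1) (k + 1) n) w
          (fun ε => fwd (signParams σ ε) G x (k + 1) 0)
          (fun ε => fwd (signParams σ ε) G' x' (k + 1) 0) s
          (growth c ^ n * ((16 * growth c ^ (n + 1)) ^ (k + 1) * inputBound x x')) := by
        rw [hdim']
        exact hc.mono h.pos (le_mul_of_one_le_left hc.nonneg (one_le_pow₀ hg))
      have h1 := concentrated_forward_skip h (by omega) (by omega)
        (dependsOn_fwd_sign σ G x (k + 1) n) (dependsOn_fwd_sign σ G' x' (k + 1) n) hc'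
        (fun _ _ he => dependsOn_fwd_sign σ G x (k + 1) 0 fun i hi => he i (hsub hi))
        (fun _ _ he => dependsOn_fwd_sign σ G' x' (k + 1) 0 fun i hi => he i (hsub hi)) hcz
      refine ⟨fun j => s j + G (k + 1) n j * G' (k + 1) n j *
        (σ ^ 2 * ∑ i ∈ Finset.range (inDim din w (k + 1) n), s' i), ?_, ?_⟩
      rotate_left
      · rw [hdim] at h1
        refine h1.mono h.pos (le_of_eq ?_)
        ring
      · rw [Finset.sum_add_distrib, ← Finset.sum_mul, hs', ← hdim, hdim', hs, ← hdim', inputGain,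
          blockGain_eq, overlap]
        ring

lemma dependsOn_bwd_sign (σ : ℝ) (G : ℕ → ℕ → ℕ → ℝ) {k m r : ℕ} (hk : k ≤ b + 1)
    (hr : r + m + 1 = d) :
    DependsOn (fun ε : Weight din w b d → ℤˣ => bwd (signParams σ ε) G k r)
      (after din w b d k m) :=
  dependsOn_signParams (dependsOn_bwd G hk hr) σ

lemma concentrated_bwd_block (h : Regime c σ w G G') {k : ℕ} (hk : k < b + 2) {S : ℝ}
    (hc : ConcentratedUpTo (din := din) (b := b) (d := d) (outDim w b d k (d - 1)) w
      (fun ε => bwdTop (signParams σ ε) G k) (fun ε => bwdTop (signParams σ ε) G' k)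
      (fun _ => S) K)
    {r m : ℕ} (hr : r + m + 1 = d) :
    ConcentratedUpTo (din := din) (b := b) (d := d) (outDim w b d k m) w
      (fun ε => bwd (signParams σ ε) G k r) (fun ε => bwd (signParams σ ε) G' k r)
      (fun _ => S * ∏ m' ∈ Finset.Ico (m + 1) d, (σ ^ 2 * overlap w b d G G' k m'))
      (growth c ^ r * K) := by
  induction r generalizing m with
  | zero =>
    have hm : d - 1 = m := by omega
    rw [hm] at hc
    rw [Finset.Ico_eq_empty (by omega), Finset.prod_empty, mul_one, pow_zero, one_mul]
    exact hc
  | succ r ih =>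
    have h1 := concentrated_backward_step h hk (m := m + 1) (by omega) (inDim_succ k m)
      (dependsOn_bwd_sign σ G (by omega) (by omega))
      (dependsOn_bwd_sign σ G' (by omega) (by omega)) (ih (m := m + 1) (by omega))
    rw [outDim_of_lt (by omega), pow_succ' (growth c), mul_assoc]
    convert h1 using 2
    · ext i
      simp only [bwd, bwdBlock, show d - 1 - r = m + 1 by omega]
    · ext i
      simp only [bwd, bwdBlock, show d - 1 - r = m + 1 by omega]
    · rw [← Finset.sum_mul, Finset.prod_eq_prod_Ico_succ_bot (show m + 1 < d by omega), overlap]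
      ring

lemma concentrated_bwdTop_last (h : Regime c σ w G G') (hd : 1 ≤ d) :
    ConcentratedUpTo (din := din) (b := b) (d := d) (outDim w b d (b + 1) (d - 1)) w
      (fun ε => bwdTop (signParams σ ε) G (b + 1)) (fun ε => bwdTop (signParams σ ε) G' (b + 1))
      (fun _ => 1) 1 := by
  have := h.pos
  rw [outDim_last hd]
  refine ⟨?_, ?_, ?_, ?_⟩
  · simp [bwdTop, avg_const]
  · simp [bwdTop, avg_const]
  · simp
  · intro a _
    simp [bwdTop, avg_const]

lemma blockGain_eq_bot {n : ℕ} (k : ℕ) : blockGain w b (n + 1) σ G G' k =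
    (σ ^ 2 * overlap w b (n + 1) G G' k 0) *
      ∏ m ∈ Finset.Ico 1 (n + 1), (σ ^ 2 * overlap w b (n + 1) G G' k m) := by
  rw [blockGain, Finset.range_eq_Ico, Finset.prod_eq_prod_Ico_succ_bot (Nat.succ_pos n)]

lemma bwdTop_sub (Θ : Params din w b d) (G : ℕ → ℕ → ℕ → ℝ) {r : ℕ} (hr : r ≤ b) :
    bwdTop Θ G (b - r) = bwdIn Θ G r := by
  rw [bwdTop, if_neg (by omega), Nat.sub_sub_self hr]

/-- Products of gradients with respect to block inputs concentrate. -/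
lemma concentrated_bwdIn (h : Regime c σ w G G') (hd : 1 ≤ d) {r : ℕ} (hr : r ≤ b) :
    ConcentratedUpTo (din := din) (b := b) (d := d) w w
      (fun ε => bwdIn (signParams σ ε) G r) (fun ε => bwdIn (signParams σ ε) G' r)
      (fun _ => gradGain w b d σ G G' r) ((16 * growth c ^ d) ^ (r + 1)) := by
  obtain ⟨n, rfl⟩ : ∃ n, d = n + 1 := ⟨d - 1, by omega⟩
  have hg := one_le_growth c
  induction r with
  | zero =>
    have h0 := concentrated_bwd_block (m := 0) h (by omega)
      (concentrated_bwdTop_last (din := din) (b := b) h hd) (r := n) (by omega)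
    have h1 := concentrated_backward_step h (by omega) (m := 0) (by omega)
      (inDim_of_pos (by omega) _)
      (dependsOn_bwd_sign σ G (by omega) (by omega))
      (dependsOn_bwd_sign σ G' (by omega) (by omega)) h0
    refine Concentrated.mono (K := growth c * (growth c ^ n * 1)) h.pos ?_ ?_
    · convert h1 using 2
      · ext i
        simp [bwdIn, bwd, bwdBlock, bwdTop]
      · ext i
        simp [bwdIn, bwd, bwdBlock, bwdTop]
      · rw [← Finset.sum_mul, gradGain, blockGain_eq_bot, overlap]
        ring
    · have : 0 ≤ growth c ^ (n + 1) := by positivity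
      rw [mul_one, ← pow_succ', zero_add, pow_one]
      linarith
  | succ r ih =>
    have ih' := ih (by omega)
    have hk : b - r < b + 2 := by omega
    have hK : (16 * growth c ^ (n + 1)) ^ (r + 1) ≤
        growth c ^ n * (16 * growth c ^ (n + 1)) ^ (r + 1) :=
      le_mul_of_one_le_left ih'.nonneg (one_le_pow₀ hg)
    have hT : ∀ (G : ℕ → ℕ → ℕ → ℝ) (ε : Weight din w b (n + 1) → ℤˣ),
        bwdTop (signParams σ ε) G (b - r) = bwdIn (signParams σ ε) G r :=
      fun G ε => bwdTop_sub _ G (by omega)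
    have h0 := concentrated_bwd_block (din := din) (m := 0) (k := b - r) (S := gradGain w b (n + 1) σ G G' r)
      h hk (K := (16 * growth c ^ (n + 1)) ^ (r + 1)) (by
        rw [outDim_of_le (Nat.sub_le b r) (n + 1 - 1)]
        simp only [hT]
        exact ih') (r := n) (by omega)
    have hdep : ∀ G : ℕ → ℕ → ℕ → ℝ,
        DependsOn (fun ε : Weight din w b (n + 1) → ℤˣ => bwdIn (signParams σ ε) G r)
          (after din w b (n + 1) (b - r) 0) := by
      intro G
      refine dependsOn_signParams (F := fun Θ => bwdIn Θ G r) (fun Θ Θ' hΘ => ?_) σ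
      refine bwdIn_congr G (by omega) fun k' hk' m' _ => weight_congr fun e h1 h2 => hΘ e ?_
      simp only [after, Set.mem_ofPred_eq]
      omega
    have h1 := concentrated_backward_skip h hk (m := 0) (by omega)
      (inDim_of_pos (by omega) _)
      (dependsOn_bwd_sign σ G (by omega) (by omega))
      (dependsOn_bwd_sign σ G' (by omega) (by omega)) h0 (hdep G) (hdep G')
      (sz := fun _ => gradGain w b (n + 1) σ G G' r) (ih'.mono h.pos hK)
    refine Concentrated.mono (K := 16 * growth c *
      (growth c ^ n * (16 * growth c ^ (n + 1)) ^ (r + 1))) h.pos ?_ (le_of_eq (by ring))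
    unfold ConcentratedUpTo at h1
    convert h1 using 2
    · ext i
      simp [bwdIn, bwd, bwdBlock, hT]
    · ext i
      simp [bwdIn, bwd, bwdBlock, hT]
    · rw [← Finset.sum_mul, gradGain, blockGain_eq_bot, overlap]
      ring

/-- The mean of the product of the gradients at a node of the output of block `k`. -/
def topGain (w b d : ℕ) (σ : ℝ) (G G' : ℕ → ℕ → ℕ → ℝ) (k : ℕ) : ℝ :=
  if k = b + 1 then 1 else gradGain w b d σ G G' (b - k)

lemma concentrated_bwdTop (h : Regime c σ w G G') (hd : 1 ≤ d) {k : ℕ} (hk : k < b + 2) :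
    ConcentratedUpTo (din := din) (b := b) (d := d) (outDim w b d k (d - 1)) w
      (fun ε => bwdTop (signParams σ ε) G k) (fun ε => bwdTop (signParams σ ε) G' k)
      (fun _ => topGain w b d σ G G' k) ((16 * growth c ^ d) ^ (b + 1)) := by
  have h16 : 1 ≤ 16 * growth c ^ d := by
    have := one_le_pow₀ (n := d) (one_le_growth c)
    linarith
  by_cases hkb : k = b + 1
  · subst hkb
    simp only [topGain, if_true]
    exact (concentrated_bwdTop_last h hd).mono h.pos (one_le_pow₀ h16)
  · simp only [topGain, bwdTop, if_neg hkb]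
    rw [outDim_of_le (by omega)]
    exact (concentrated_bwdIn h hd (by omega)).mono h.pos (pow_le_pow_right₀ h16 (by omega))

/-- The mean of the contribution of layer `(k, m)` to the kernel. -/
def layerMean (w b d : ℕ) (σ : ℝ) (G G' : ℕ → ℕ → ℕ → ℝ) (x x' : Fin din → ℝ) (k m : ℕ) : ℝ :=
  ((∑ i, x i * x' i) * inputGain w b d σ G G' k *
      ∏ m' ∈ Finset.range m, (σ ^ 2 * overlap w b d G G' k m')) *
    (overlap w b d G G' k m * (topGain w b d σ G G' k *
      ∏ m' ∈ Finset.Ico (m + 1) d, (σ ^ 2 * overlap w b d G G' k m')))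

/-- A constant for the concentration of all layers. -/
def networkBound (b d : ℕ) (c : ℝ) (x x' : Fin din → ℝ) : ℝ :=
  growth c ^ d * (16 * growth c ^ d) ^ (b + 1) * (1 + inputBound x x')

lemma inputBound_nonneg (x x' : Fin din → ℝ) : 0 ≤ inputBound x x' := by
  have : 0 ≤ ∑ i, |x i * x' i| := Finset.sum_nonneg fun _ _ => abs_nonneg _
  unfold inputBound
  positivity

lemma avg_sq_layer_le (h : Regime c σ w G G') (x x' : Fin din → ℝ) {k m : ℕ} (hk : k < b + 2)
    (hm : m < d) :
    avg (fun ε : Weight din w b d → ℤˣ =>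
      (fwdInner (signParams σ ε) G G' x x' k m * bwdInner (signParams σ ε) G G' k m -
        layerMean w b d σ G G' x x' k m) ^ 2) ≤
      (2 * networkBound b d c x x' ^ 2 + 2 * networkBound b d c x x' ^ 3) / w := by
  have hd : 1 ≤ d := by omega
  have hg := one_le_growth c
  have hg0 : 0 ≤ growth c := by linarith
  have hI := inputBound_nonneg x x'
  have h16 : 1 ≤ 16 * growth c ^ d := by
    have := one_le_pow₀ (n := d) hg
    linarith
  obtain ⟨s, hs, hc⟩ := concentrated_fwd_zero (b := b) h x x' hd hk
  obtain ⟨s, hs, hc⟩ := concentrated_fwd_block h x x' hk hs hc hm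
  have hr : d - 1 - m + m + 1 = d := by omega
  have hv := concentrated_gated h (concentrated_bwd_block h hk
    (concentrated_bwdTop (din := din) h hd hk) hr)
  have hB1 : growth c ^ m * ((16 * growth c ^ d) ^ k * inputBound x x') ≤
      networkBound b d c x x' := by
    rw [← mul_assoc]
    unfold networkBound
    gcongr
    all_goals first | exact h16 | exact hg | omega | linarith
  have hB2 : growth c ^ (d - 1 - m) * (16 * growth c ^ d) ^ (b + 1) ≤
      networkBound b d c x x' := by
    unfold networkBound
    refine le_trans ?_ (le_mul_of_one_le_right (by positivity) (by linarith))
    gcongr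
    all_goals first | exact hg | omega
  have hgate : ∀ {y : (Weight din w b d → ℤˣ) → ℕ → ℝ} (G : ℕ → ℕ → ℕ → ℝ),
      DependsOn y (after din w b d k m) →
      DependsOn (fun ε j => G k m j * y ε j) (after din w b d k m) := by
    intro y G hy x x' hx
    simp only [hy hx]
  have key := avg_sq_inner_mul_inner_sub_le h.one_le (disjoint_before_after k m)
    (hc.mono h.pos hB1) (hv.mono h.pos hB2)
    (dependsOn_restrict (dependsOn_fwd_sign σ G x k m) _)
    (dependsOn_restrict (dependsOn_fwd_sign σ G' x' k m) _)
    (dependsOn_restrict (hgate G (dependsOn_bwd_sign σ G (by omega) hr)) _)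
    (dependsOn_restrict (hgate G' (dependsOn_bwd_sign σ G' (by omega) hr)) _)
  refine le_trans (le_of_eq ?_) key
  congr 1
  ext ε
  congr 2
  rw [← Finset.sum_mul, Fin.sum_univ_eq_sum_range s, hs,
    Fin.sum_univ_eq_sum_range (fun j => G k m j * G' k m j), layerMean, overlap]

/-- The kernel concentrates around the sum of the layer means. -/
lemma avg_sq_kernel_le (h : Regime c σ w G G') (x x' : Fin din → ℝ) :
    avg (fun ε : Weight din w b d → ℤˣ =>
      ((∑ l : Fin (b + 2) × Fin d,
          fwdInner (signParams σ ε) G G' x x' l.1 l.2 * bwdInner (signParams σ ε) G G' l.1 l.2) -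
        ∑ l : Fin (b + 2) × Fin d, layerMean w b d σ G G' x x' l.1 l.2) ^ 2) ≤
      (((b + 2) * d : ℕ) : ℝ) ^ 2 *
        (2 * networkBound b d c x x' ^ 2 + 2 * networkBound b d c x x' ^ 3) / w := by
  simp only [← Finset.sum_sub_distrib]
  calc _ ≤ avg (fun ε : Weight din w b d → ℤˣ => (((b + 2) * d : ℕ) : ℝ) *
        ∑ l : Fin (b + 2) × Fin d,
          (fwdInner (signParams σ ε) G G' x x' l.1 l.2 * bwdInner (signParams σ ε) G G' l.1 l.2 -
            layerMean w b d σ G G' x x' l.1 l.2) ^ 2) := by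
        refine avg_mono fun ε => ?_
        refine sq_sum_le_card_mul_sum_sq.trans (le_of_eq ?_)
        simp
    _ ≤ (((b + 2) * d : ℕ) : ℝ) * ∑ _l : Fin (b + 2) × Fin d,
          (2 * networkBound b d c x x' ^ 2 + 2 * networkBound b d c x x' ^ 3) / w := by
        rw [avg_const_mul, avg_sum]
        gcongr with l _
        exact avg_sq_layer_le h x x' l.1.2 l.2.2
    _ = _ := by
        simp
        ring

end NetworkConcentration

/-! ### The mean of the kernel -/

section Mean

variable {din w b d : ℕ} {σ : ℝ} {G G' : ℕ → ℕ → ℕ → ℝ}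

lemma inputGain_succ (k : ℕ) : inputGain w b d σ G G' (k + 1) =
    blockGain w b d σ G G' 0 * ∏ i ∈ Finset.Ico 1 (k + 1), (1 + blockGain w b d σ G G' i) := by
  induction k with
  | zero => simp [inputGain]
  | succ k ih => rw [inputGain, ih, Finset.prod_Ico_succ_top (Nat.le_add_left 1 k), mul_assoc]

lemma gradGain_eq {r : ℕ} (hr : r ≤ b) : gradGain w b d σ G G' r =
    blockGain w b d σ G G' (b + 1) *
      ∏ i ∈ Finset.Ico (b + 1 - r) (b + 1), (1 + blockGain w b d σ G G' i) := by
  induction r with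
  | zero => simp [gradGain]
  | succ r ih =>
    have h1 : b + 1 - (r + 1) = b - r := by omega
    have h2 : b + 1 - r = b - r + 1 := by omega
    rw [gradGain, ih (by omega), h1, h2,
      Finset.prod_eq_prod_Ico_succ_bot (show b - r < b + 1 by omega)]
    ring

lemma topGain_of_le {k : ℕ} (hk : k ≤ b) : topGain w b d σ G G' k =
    blockGain w b d σ G G' (b + 1) *
      ∏ i ∈ Finset.Ico (k + 1) (b + 1), (1 + blockGain w b d σ G G' i) := by
  rw [topGain, if_neg (by omega), gradGain_eq (by omega), show b + 1 - (b - k) = k + 1 by omega]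

lemma sq_mul_layerMean (x x' : Fin din → ℝ) (k : ℕ) {m : ℕ} (hm : m < d) :
    σ ^ 2 * layerMean w b d σ G G' x x' k m = (∑ i, x i * x' i) *
      (inputGain w b d σ G G' k * blockGain w b d σ G G' k * topGain w b d σ G G' k) := by
  have h : blockGain w b d σ G G' k =
      (∏ m' ∈ Finset.range m, (σ ^ 2 * overlap w b d G G' k m')) *
        ((σ ^ 2 * overlap w b d G G' k m) *
          ∏ m' ∈ Finset.Ico (m + 1) d, (σ ^ 2 * overlap w b d G G' k m')) := by
    rw [blockGain, ← Finset.prod_eq_prod_Ico_succ_bot hm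
        (fun m' => σ ^ 2 * overlap w b d G G' k m'),
      Finset.prod_range_mul_prod_Ico _ hm.le]
  rw [layerMean, h]
  ring

lemma sum_powerset_card_mul_prod {ι : Type*} [DecidableEq ι] (T : Finset ι) (τ : ι → ℝ) :
    ∑ J ∈ T.powerset, (J.card : ℝ) * ∏ k ∈ J, τ k =
      ∑ k ∈ T, τ k * ∏ i ∈ T.erase k, (1 + τ i) := by
  induction T using Finset.induction_on with
  | empty => simp
  | insert a T ha ih =>
    have h1 : ∀ J ∈ T.powerset, ((insert a J).card : ℝ) * ∏ k ∈ insert a J, τ k =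
        τ a * ((J.card : ℝ) * ∏ k ∈ J, τ k) + τ a * ∏ k ∈ J, τ k := by
      intro J hJ
      have haJ : a ∉ J := fun h => ha (Finset.mem_powerset.1 hJ h)
      rw [Finset.card_insert_of_notMem haJ, Finset.prod_insert haJ]
      push_cast
      ring
    have h2 : ∀ k ∈ T, τ k * ∏ i ∈ (insert a T).erase k, (1 + τ i) =
        (1 + τ a) * (τ k * ∏ i ∈ T.erase k, (1 + τ i)) := by
      intro k hk
      have hak : a ≠ k := fun h => ha (h ▸ hk)
      rw [Finset.erase_insert_of_ne hak,
        Finset.prod_insert fun h => ha (Finset.mem_of_mem_erase h)]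
      ring
    rw [Finset.sum_powerset_insert ha, Finset.sum_congr rfl h1, Finset.sum_add_distrib,
      ← Finset.mul_sum, ← Finset.mul_sum, ih, Finset.sum_insert ha, Finset.erase_insert ha,
      Finset.sum_congr rfl h2, ← Finset.mul_sum, Finset.prod_one_add]
    ring

lemma sum_range_add_two (f : ℕ → ℝ) (b : ℕ) :
    ∑ k ∈ Finset.range (b + 2), f k = f 0 + f (b + 1) + ∑ k ∈ Finset.Icc 1 b, f k := by
  have h : Finset.Icc 1 b = Finset.Ico 1 (b + 1) := by
    ext
    simp
  rw [Finset.sum_range_succ, Finset.range_eq_Ico, Finset.sum_eq_sum_Ico_succ_bot (by omega), h]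
  ring

/-- The sum of the layer means as a sum over sub-networks. -/
lemma sq_mul_sum_layerMean (x x' : Fin din → ℝ) :
    σ ^ 2 * ∑ l : Fin (b + 2) × Fin d, layerMean w b d σ G G' x x' l.1 l.2 =
      ∑ J ∈ (Finset.Icc 1 b).powerset, ((J.card + 2 : ℕ) : ℝ) * d * ((∑ i, x i * x' i) *
        (blockGain w b d σ G G' 0 * blockGain w b d σ G G' (b + 1) *
          ∏ k ∈ J, blockGain w b d σ G G' k)) := by
  set τ := blockGain w b d σ G G' with hτ
  set X := ∑ i, x i * x' i
  have hI : Finset.Ico 1 (b + 1) = Finset.Icc 1 b := by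
    ext
    simp
  have h1 : σ ^ 2 * ∑ l : Fin (b + 2) × Fin d, layerMean w b d σ G G' x x' l.1 l.2 =
      ∑ k ∈ Finset.range (b + 2), d * (X *
        (inputGain w b d σ G G' k * τ k * topGain w b d σ G G' k)) := by
    rw [Fintype.sum_prod_type, Finset.mul_sum, Finset.sum_range]
    refine Finset.sum_congr rfl fun k _ => ?_
    rw [Finset.mul_sum, Finset.sum_congr rfl fun m _ => sq_mul_layerMean x x' k m.2]
    simp [X, τ]
  have h2 : ∀ k ∈ Finset.Icc 1 b, d * (X *
      (inputGain w b d σ G G' k * τ k * topGain w b d σ G G' k)) =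
      d * X * τ 0 * τ (b + 1) * (τ k * ∏ i ∈ (Finset.Icc 1 b).erase k, (1 + τ i)) := by
    intro k hk
    obtain ⟨hk1, hk2⟩ := Finset.mem_Icc.1 hk
    obtain ⟨n, rfl⟩ : ∃ n, k = n + 1 := ⟨k - 1, by omega⟩
    have h3 : (Finset.Icc 1 b).erase (n + 1) =
        Finset.Ico 1 (n + 1) ∪ Finset.Ico (n + 1 + 1) (b + 1) := by
      ext i
      simp only [Finset.mem_erase, Finset.mem_Icc, Finset.mem_union, Finset.mem_Ico]
      omega
    have h4 : Disjoint (Finset.Ico 1 (n + 1)) (Finset.Ico (n + 1 + 1) (b + 1)) := by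
      rw [Finset.disjoint_left]
      intro i hi hi'
      simp only [Finset.mem_Ico] at hi hi'
      omega
    rw [inputGain_succ, topGain_of_le hk2, h3, Finset.prod_union h4]
    ring
  have h5 : ∀ J ∈ (Finset.Icc 1 b).powerset, ((J.card + 2 : ℕ) : ℝ) * d * (X *
        (τ 0 * τ (b + 1) * ∏ k ∈ J, τ k)) =
      d * X * τ 0 * τ (b + 1) * (J.card * ∏ k ∈ J, τ k) +
        2 * (d * X * τ 0 * τ (b + 1)) * ∏ k ∈ J, τ k := by
    intro J _
    push_cast
    ring
  rw [h1, sum_range_add_two, Finset.sum_congr rfl h2, Finset.sum_congr rfl h5,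
    Finset.sum_add_distrib, ← Finset.mul_sum, ← Finset.mul_sum, ← Finset.mul_sum,
    sum_powerset_card_mul_prod, ← Finset.prod_one_add, topGain_of_le (Nat.zero_le b),
    inputGain_succ, ← hI, topGain, if_pos rfl, inputGain]
  ring

lemma overlap_openOutput_last (hd : 1 ≤ d) (g g' : ℕ → ℕ → ℕ → ℝ) :
    overlap w b d (openOutput b d g) (openOutput b d g') (b + 1) (d - 1) = 1 := by
  rw [overlap, outDim_last hd]
  simp [openOutput, Nat.sub_add_cancel hd]

lemma overlap_openOutput (g g' : ℕ → ℕ → ℕ → ℝ) {k m : ℕ} (h : ¬(k = b + 1 ∧ m + 1 = d)) :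
    overlap w b d (openOutput b d g) (openOutput b d g') k m =
      ∑ j : Fin w, g k m j * g' k m j := by
  rw [overlap, outDim, if_neg h, ← Fin.sum_univ_eq_sum_range]
  simp [openOutput, h]

/-- The path kernel factorizes over the layers. -/
lemma npk_eq (hd : 1 ≤ d) (Θf : Params din w b d) (x x' : Fin din → ℝ) (J : Finset ℕ) :
    npk Θf J x x' = (∑ i, x i * x' i) *
      ∏ k ∈ insert 0 (insert (b + 1) J), ∏ m ∈ Finset.range d,
        overlap w b d (openOutput b d (gate Θf x)) (openOutput b d (gate Θf x')) k m := by
  set ov := overlap w b d (openOutput b d (gate Θf x)) (openOutput b d (gate Θf x'))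
  have h1 : npk Θf J x x' = (∑ i, x i * x' i) * ∏ l : ↥(hiddenLayers b d J),
      ∑ j : Fin w, gate Θf x l.1.1 l.1.2 j * gate Θf x' l.1.1 l.1.2 j := by
    rw [npk, Fintype.sum_prod_type, Finset.prod_univ_sum, Fintype.piFinset_univ,
      Finset.sum_mul_sum]
    refine Finset.sum_congr rfl fun i _ => Finset.sum_congr rfl fun q _ => ?_
    simp only [pathFeature, activity, Finset.prod_mul_distrib]
    ring
  have h2 : ∀ l : ↥(hiddenLayers b d J),
      ∑ j : Fin w, gate Θf x l.1.1 l.1.2 j * gate Θf x' l.1.1 l.1.2 j = ov l.1.1 l.1.2 := by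
    intro l
    refine (overlap_openOutput _ _ fun h => ?_).symm
    refine (Finset.mem_erase.1 l.2).1 (Prod.ext h.1 ?_)
    simp only
    omega
  rw [h1, Finset.prod_congr rfl fun l _ => h2 l,
    Finset.prod_coe_sort (hiddenLayers b d J) fun l => ov l.1 l.2, hiddenLayers,
    Finset.prod_erase (f := fun l : ℕ × ℕ => ov l.1 l.2) _ (overlap_openOutput_last hd _ _), Finset.prod_product]

/-- The mean of the kernel is the limit kernel. -/
lemma sum_layerMean_eq (hd : 1 ≤ d) (hσ : σ ≠ 0) (Θf : Params din w b d) (x x' : Fin din → ℝ) :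
    ∑ l : Fin (b + 2) × Fin d, layerMean w b d σ (openOutput b d (gate Θf x))
      (openOutput b d (gate Θf x')) x x' l.1 l.2 = limitKernel σ Θf x x' := by
  refine mul_left_cancel₀ (pow_ne_zero 2 hσ) ?_
  rw [sq_mul_sum_layerMean, limitKernel, Finset.mul_sum]
  refine Finset.sum_congr rfl fun J hJ => ?_
  have hJ0 : ∀ k ∈ J, 1 ≤ k ∧ k ≤ b := fun k hk =>
    Finset.mem_Icc.1 (Finset.mem_powerset.1 hJ hk)
  have hb : b + 1 ∉ J := fun h => by
    have := hJ0 _ h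
    omega
  have h0 : 0 ∉ insert (b + 1) J := fun h => by
    rcases Finset.mem_insert.1 h with h | h
    · omega
    · have := hJ0 _ h
      omega
  have hprod : ∏ k ∈ insert 0 (insert (b + 1) J),
      blockGain w b d σ (openOutput b d (gate Θf x)) (openOutput b d (gate Θf x')) k =
      σ ^ (2 * ((J.card + 2) * d)) *
        ∏ k ∈ insert 0 (insert (b + 1) J), ∏ m ∈ Finset.range d,
          overlap w b d (openOutput b d (gate Θf x)) (openOutput b d (gate Θf x')) k m := by
    simp only [blockGain, Finset.prod_mul_distrib, Finset.prod_const, Finset.card_range]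
    rw [Finset.card_insert_of_notMem h0, Finset.card_insert_of_notMem hb, ← pow_mul, ← pow_mul]
    congr 2
    ring
  have hpow : σ ^ (2 * ((J.card + 2) * d)) = σ ^ 2 * σ ^ (2 * ((J.card + 2) * d - 1)) := by
    rw [← pow_add]
    congr 1
    have : 1 ≤ (J.card + 2) * d := Nat.mul_pos (by omega) hd
    omega
  have hins := hprod
  rw [Finset.prod_insert h0, Finset.prod_insert hb] at hins
  rw [betaRes, npk_eq hd, mul_assoc (blockGain _ _ _ _ _ _ 0), hins, hpow]
  ring

end Mean

/-! ### Measurability -/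

section Measurability

variable {din w b d : ℕ} {Ω : Type*} [MeasurableSpace Ω] {Θ : Ω → Params din w b d}

lemma measurable_weight (hΘ : Measurable Θ) (k m i j : ℕ) :
    Measurable fun ω => weight (Θ ω) k m i j := by
  unfold weight
  split_ifs
  · exact (measurable_pi_apply _).comp hΘ
  · exact measurable_const

lemma measurable_linearLayer (hΘ : Measurable Θ) (k m j : ℕ) {z : Ω → ℕ → ℝ}
    (hz : ∀ i, Measurable fun ω => z ω i) : Measurable fun ω => linearLayer (Θ ω) k m (z ω) j :=
  Finset.measurable_fun_sum _ fun i _ => (measurable_weight hΘ k m i j).mul (hz i)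

variable {act : Ω → ℕ → ℕ → ℕ → ℝ → ℝ}

lemma measurable_runBlock (hΘ : Measurable Θ)
    (hact : ∀ k m j (q : Ω → ℝ), Measurable q → Measurable fun ω => act ω k m j (q ω)) (k : ℕ)
    {z : Ω → ℕ → ℝ} (hz : ∀ i, Measurable fun ω => z ω i) (m j : ℕ) :
    Measurable fun ω => runBlock (Θ ω) (act ω) k (z ω) m j := by
  induction m generalizing j with
  | zero => exact hz j
  | succ m ih => exact hact _ _ _ _ (measurable_linearLayer hΘ k m j ih)

lemma measurable_blockInput (hΘ : Measurable Θ)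
    (hact : ∀ k m j (q : Ω → ℝ), Measurable q → Measurable fun ω => act ω k m j (q ω))
    (x : Fin din → ℝ) (k j : ℕ) : Measurable fun ω => blockInput (Θ ω) (act ω) x k j := by
  match k with
  | 0 => exact measurable_const
  | 1 => exact measurable_runBlock (z := fun _ => inputVec x) hΘ hact 0 (fun _ => measurable_const) d j
  | k + 2 =>
    exact (measurable_blockInput hΘ hact x (k + 1) j).add
      (measurable_runBlock hΘ hact (k + 1) (measurable_blockInput hΘ hact x (k + 1)) d j)

lemma measurable_step : Measurable step :=
  Measurable.ite measurableSet_Ioi measurable_const measurable_const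

lemma measurable_gate (hΘ : Measurable Θ) (x : Fin din → ℝ) (k m j : ℕ) :
    Measurable fun ω => gate (Θ ω) x k m j := by
  have hact : ∀ k m j (q : Ω → ℝ), Measurable q → Measurable fun ω => relu k m j (q ω) :=
    fun k m j q hq => hq.mul (measurable_step.comp hq)
  exact measurable_step.comp (measurable_linearLayer hΘ k m j
    (measurable_runBlock (act := fun _ => relu) hΘ hact k
      (measurable_blockInput (act := fun _ => relu) hΘ hact x k) m))

variable {G : Ω → ℕ → ℕ → ℕ → ℝ}

lemma measurable_fwd (hΘ : Measurable Θ) (hG : ∀ k m j, Measurable fun ω => G ω k m j)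
    (x : Fin din → ℝ) (k m i : ℕ) : Measurable fun ω => fwd (Θ ω) (G ω) x k m i := by
  have hact : ∀ k m j (q : Ω → ℝ), Measurable q →
      Measurable fun ω => gatedAct (G ω) k m j (q ω) := fun k m j q hq => hq.mul (hG k m j)
  exact measurable_runBlock (act := fun ω => gatedAct (G ω)) hΘ hact k
    (measurable_blockInput (act := fun ω => gatedAct (G ω)) hΘ hact x k) m i

lemma measurable_bwdBlock (hΘ : Measurable Θ) (hG : ∀ k m j, Measurable fun ω => G ω k m j)
    (k : ℕ) {y : Ω → ℕ → ℝ} (hy : ∀ i, Measurable fun ω => y ω i) (r i : ℕ) :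
    Measurable fun ω => bwdBlock (Θ ω) (G ω) k (y ω) r i := by
  induction r generalizing i with
  | zero => exact hy i
  | succ r ih =>
    exact Finset.measurable_fun_sum _ fun j _ =>
      (measurable_weight hΘ _ _ _ _).mul ((hG _ _ _).mul (ih j))

lemma measurable_bwdIn (hΘ : Measurable Θ) (hG : ∀ k m j, Measurable fun ω => G ω k m j)
    (r i : ℕ) : Measurable fun ω => bwdIn (Θ ω) (G ω) r i := by
  induction r generalizing i with
  | zero => exact measurable_bwdBlock hΘ hG _ (fun _ => measurable_const) d i
  | succ r ih => exact (ih i).add (measurable_bwdBlock hΘ hG _ ih d i)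

lemma measurable_bwd (hΘ : Measurable Θ) (hG : ∀ k m j, Measurable fun ω => G ω k m j)
    (k r i : ℕ) : Measurable fun ω => bwd (Θ ω) (G ω) k r i := by
  refine measurable_bwdBlock hΘ hG k (fun i => ?_) r i
  unfold bwdTop
  split_ifs
  · exact measurable_const
  · exact measurable_bwdIn hΘ hG _ i

lemma measurable_openOutput (hG : ∀ k m j, Measurable fun ω => G ω k m j) (k m j : ℕ) :
    Measurable fun ω => openOutput b d (G ω) k m j := by
  unfold openOutput
  split_ifs
  · exact measurable_const
  · exact hG k m j

lemma measurable_ntk (hd : 1 ≤ d) {Θf Θv : Ω → Params din w b d} (hf : Measurable Θf)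
    (hv : Measurable Θv) (x x' : Fin din → ℝ) :
    Measurable fun ω => ntk (Θf ω) (Θv ω) x x' := by
  have hg : ∀ x : Fin din → ℝ, ∀ k m j,
      Measurable fun ω => openOutput b d (gate (Θf ω) x) k m j :=
    fun x => measurable_openOutput fun k m j => measurable_gate hf x k m j
  simp only [ntk_eq hd, fwdInner, bwdInner]
  exact Finset.measurable_fun_sum _ fun l _ =>
    (Finset.measurable_fun_sum _ fun i _ => (measurable_fwd hv (hg x) x _ _ _).mul
      (measurable_fwd hv (hg x') x' _ _ _)).mul
    (Finset.measurable_fun_sum _ fun j _ => ((hg x _ _ _).mul (measurable_bwd hv (hg x) _ _ _)).mul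
      ((hg x' _ _ _).mul (measurable_bwd hv (hg x') _ _ _)))

lemma measurable_limitKernel (σ : ℝ) {Θf : Ω → Params din w b d} (hf : Measurable Θf)
    (x x' : Fin din → ℝ) : Measurable fun ω => limitKernel σ (Θf ω) x x' := by
  have hp : ∀ (x : Fin din → ℝ) (J : Finset ℕ) (p : SubPath din w b d J),
      Measurable fun ω => pathFeature (Θf ω) x J p := fun x J p =>
    measurable_const.mul (Finset.measurable_fun_prod _ fun l _ => measurable_gate hf x _ _ _)
  exact Finset.measurable_fun_sum _ fun J _ => measurable_const.mul
    (Finset.measurable_fun_sum _ fun p _ => (hp x J p).mul (hp x' J p))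

end Measurability

/-! ### From sign averages to probability spaces -/

section Probability

variable {E : Type*} [Fintype E] [DecidableEq E]

/-- The uniform distribution on the parameters `σ ε`. -/
def signMeasure (E : Type*) [Fintype E] [DecidableEq E] (σ : ℝ) : Measure (E → ℝ) :=
  (2⁻¹ : ENNReal) ^ Fintype.card E •
    ∑ ε : E → ℤˣ, Measure.dirac fun e => σ * sgn (ε e)

lemma signLaw_eq (σ : ℝ) (s : Set ℝ) :
    signLaw σ s = ∑ u : ℤˣ, (2⁻¹ : ENNReal) * Measure.dirac (σ * sgn u) s := by
  have : (Finset.univ : Finset ℤˣ) = {1, -1} := rfl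
  rw [this, Finset.sum_pair (by decide)]
  simp [signLaw, sgn]

instance (σ : ℝ) : IsFiniteMeasure (signLaw σ) := by
  unfold signLaw
  constructor
  simp [ENNReal.inv_lt_top]

lemma pi_signLaw (σ : ℝ) : Measure.pi (fun _ : E => signLaw σ) = signMeasure E σ := by
  classical
  refine Measure.pi_eq fun s hs => ?_
  simp only [signLaw_eq σ]
  rw [Finset.prod_univ_sum, Fintype.piFinset_univ, signMeasure, Measure.smul_apply,
    Measure.finsetSum_apply, smul_eq_mul, Finset.mul_sum]
  refine Finset.sum_congr rfl fun ε _ => ?_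
  rw [Finset.prod_mul_distrib, Finset.prod_const, Finset.card_univ,
    Measure.dirac_apply' _ (MeasurableSet.univ_pi hs)]
  congr 1
  simp only [Measure.dirac_apply' _ (hs _), Set.indicator_apply, Pi.one_apply, Set.mem_univ_pi]
  split_ifs with h
  · exact (Finset.prod_eq_one fun e _ => if_pos (h e)).symm
  · obtain ⟨e, he⟩ := not_forall.1 h
    exact (Finset.prod_eq_zero (Finset.mem_univ e) (if_neg he)).symm

lemma lintegral_signMeasure (σ : ℝ) {f : (E → ℝ) → ℝ} (hf : Measurable f) (h0 : ∀ v, 0 ≤ f v) :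
    ∫⁻ v, ENNReal.ofReal (f v) ∂signMeasure E σ =
      ENNReal.ofReal (avg fun ε => f fun e => σ * sgn (ε e)) := by
  have hm : Measurable fun v => ENNReal.ofReal (f v) := hf.ennreal_ofReal
  rw [signMeasure, lintegral_smul_measure, lintegral_finsetSum_measure, avg,
    ENNReal.ofReal_div_of_pos (by exact_mod_cast Fintype.card_pos),
    ENNReal.ofReal_sum_of_nonneg fun _ _ => h0 _]
  simp only [lintegral_dirac' _ hm]
  rw [smul_eq_mul, ENNReal.div_eq_inv_mul, ENNReal.ofReal_natCast]
  congr 1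
  rw [Fintype.card_fun, Fintype.card_units_int, ← ENNReal.inv_pow]
  norm_num

/-- Averaging over the signs bounds mean squares. -/
lemma lintegral_sq_le {Ω F : Type*} [MeasurableSpace Ω] [MeasurableSpace F] {P : Measure Ω}
    [IsProbabilityMeasure P] {σ C : ℝ} {U : Ω → E → ℝ} {V : Ω → F} (hU : Measurable U)
    (hV : Measurable V) (hiid : iIndepFun (fun e ω => U ω e) P)
    (hlaw : ∀ e, P.map (fun ω => U ω e) = signLaw σ) (hindep : IndepFun U V P)
    {f : (E → ℝ) × F → ℝ} (hf : Measurable f)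
    (hC : ∀ v, avg (fun ε => f (fun e => σ * sgn (ε e), v) ^ 2) ≤ C) :
    ∫⁻ ω, ENNReal.ofReal (f (U ω, V ω) ^ 2) ∂P ≤ ENNReal.ofReal C := by
  have hUlaw : P.map U = signMeasure E σ := by
    have h : P.map U = Measure.pi fun e => P.map fun ω => U ω e :=
      (iIndepFun_iff_map_fun_eq_pi_map
        fun e => ((measurable_pi_apply e).comp hU).aemeasurable).1 hiid
    rw [h, ← pi_signLaw]
    exact congrArg Measure.pi (funext hlaw)
  have hprod := (indepFun_iff_map_prod_eq_prod_map_map hU.aemeasurable hV.aemeasurable).1 hindep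
  have hP : IsProbabilityMeasure (P.map U) := Measure.isProbabilityMeasure_map hU.aemeasurable
  have hP' : IsProbabilityMeasure (P.map V) := Measure.isProbabilityMeasure_map hV.aemeasurable
  have hm : Measurable fun p => ENNReal.ofReal (f p ^ 2) := (hf.pow_const 2).ennreal_ofReal
  calc ∫⁻ ω, ENNReal.ofReal (f (U ω, V ω) ^ 2) ∂P
      = ∫⁻ p, ENNReal.ofReal (f p ^ 2) ∂(P.map U).prod (P.map V) := by
        rw [← hprod, lintegral_map hm (hU.prodMk hV)]
    _ = ∫⁻ v, ∫⁻ u, ENNReal.ofReal (f (u, v) ^ 2) ∂P.map U ∂P.map V :=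
        lintegral_prod_symm' _ hm
    _ ≤ ∫⁻ _v, ENNReal.ofReal C ∂P.map V := by
        refine lintegral_mono fun v => ?_
        have hfv : Measurable fun u => f (u, v) ^ 2 :=
          (hf.comp (measurable_id.prodMk measurable_const)).pow_const 2
        rw [hUlaw, lintegral_signMeasure σ hfv fun _ => sq_nonneg _]
        exact ENNReal.ofReal_le_ofReal (hC v)
    _ = ENNReal.ofReal C := by simp

lemma eLpNorm_two_le {Ω : Type*} [MeasurableSpace Ω] {P : Measure Ω} {f : Ω → ℝ} {C : ℝ}
    (h : ∫⁻ ω, ENNReal.ofReal (f ω ^ 2) ∂P ≤ ENNReal.ofReal C) :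
    eLpNorm f 2 P ≤ ENNReal.ofReal C ^ (1 / 2 : ℝ) := by
  rw [eLpNorm_eq_lintegral_rpow_enorm_toReal two_ne_zero ENNReal.ofNat_ne_top]
  simp only [ENNReal.toReal_ofNat]
  refine ENNReal.rpow_le_rpow (le_trans (le_of_eq ?_) h) (by norm_num)
  refine lintegral_congr fun ω => ?_
  rw [Real.enorm_eq_ofReal_abs, ENNReal.rpow_ofNat, ← ENNReal.ofReal_pow (abs_nonneg _), sq_abs]

lemma measure_ge_le_of_lintegral_sq_le {Ω : Type*} [MeasurableSpace Ω] {P : Measure Ω}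
    {f : Ω → ℝ} {C ε : ℝ} (hf : Measurable f) (hε : 0 < ε)
    (h : ∫⁻ ω, ENNReal.ofReal (f ω ^ 2) ∂P ≤ ENNReal.ofReal C) :
    P {ω | ε ≤ |f ω|} ≤ ENNReal.ofReal C / ENNReal.ofReal (ε ^ 2) := by
  have h1 := meas_ge_le_lintegral_div (μ := P) (hf.pow_const 2).ennreal_ofReal.aemeasurable
    (ε := ENNReal.ofReal (ε ^ 2)) (by simpa using by positivity) ENNReal.ofReal_ne_top
  refine (measure_mono fun ω hω => ?_).trans (h1.trans (ENNReal.div_le_div_right h _))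
  refine ENNReal.ofReal_le_ofReal ?_
  rw [← sq_abs (f ω)]
  exact pow_le_pow_left₀ hε.le hω 2

end Probability

/-- The constant in the mean square bound. -/
def varianceBound {din : ℕ} (b d : ℕ) (c : ℝ) (x x' : Fin din → ℝ) : ℝ :=
  (((b + 2) * d : ℕ) : ℝ) ^ 2 *
    (2 * networkBound b d c x x' ^ 2 + 2 * networkBound b d c x x' ^ 3)

lemma abs_openOutput_gate_le {din w b d : ℕ} (Θf : Params din w b d) (x : Fin din → ℝ)
    (k m j : ℕ) : |openOutput b d (gate Θf x) k m j| ≤ 1 := by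
  unfold openOutput gate
  split_ifs
  · simp
  · rcases step_eq_zero_or_one (preAct Θf relu x k m j) with h | h <;> simp [h]

/-- For fixed gates, the variance of the kernel is of order `1 / w`. -/
lemma avg_sq_ntk_sub_le {din w b d : ℕ} (hd : 1 ≤ d) {c : ℝ} (hc : 0 < c) (hw : 1 ≤ w)
    (x x' : Fin din → ℝ) (Θf : Params din w b d) :
    avg (fun ε : Weight din w b d → ℤˣ =>
      (ntk Θf (signParams (c / √(w : ℝ)) ε) x x' - limitKernel (c / √(w : ℝ)) Θf x x') ^ 2) ≤
      varianceBound b d c x x' / w := by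
  have hw1 : (1 : ℝ) ≤ w := by exact_mod_cast hw
  have hw0 : (0 : ℝ) < w := by linarith
  have hσ : c / √(w : ℝ) ≠ 0 := (div_pos hc (Real.sqrt_pos.2 hw0)).ne'
  have hR : Regime c (c / √(w : ℝ)) w (openOutput b d (gate Θf x))
      (openOutput b d (gate Θf x')) :=
    ⟨hw1, by rw [div_pow, Real.sq_sqrt hw0.le]; field_simp,
      abs_openOutput_gate_le Θf x, abs_openOutput_gate_le Θf x'⟩
  have := avg_sq_kernel_le (din := din) (b := b) (d := d) hR x x'
  rw [sum_layerMean_eq hd hσ] at this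
  simpa only [ntk_eq hd, varianceBound] using this

end ResDGN

end

theorem mainTheorem5 (din b d : ℕ) (hd : 1 ≤ d) (c : ℝ) (hc : 0 < c)
    {Ω : ℕ → Type*} [∀ w, MeasurableSpace (Ω w)]
    (P : ∀ w, Measure (Ω w)) [∀ w, IsProbabilityMeasure (P w)]
    (Θf Θv : ∀ w, Ω w → ResDGN.Params din w b d)
    (hΘf : ∀ w, Measurable (Θf w)) (hΘv : ∀ w, Measurable (Θv w))
    (hiid : ∀ w, iIndepFun (fun (e : ResDGN.Weight din w b d) (ω : Ω w) => Θv w ω e) (P w))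
    (hlaw : ∀ w, ∀ e : ResDGN.Weight din w b d,
      (P w).map (fun ω => Θv w ω e) = ResDGN.signLaw (c / √(w : ℝ)))
    (hindep : ∀ w, IndepFun (Θv w) (Θf w) (P w))
    (x x' : Fin din → ℝ) :
    Tendsto (fun w : ℕ => eLpNorm (fun ω => ResDGN.ntk (Θf w ω) (Θv w ω) x x' -
        ResDGN.limitKernel (c / √(w : ℝ)) (Θf w ω) x x') 2 (P w)) atTop (𝓝 0) ∧
      ∀ ε : ℝ, 0 < ε →
        Tendsto (fun w : ℕ => P w {ω | ε ≤ |ResDGN.ntk (Θf w ω) (Θv w ω) x x' -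
          ResDGN.limitKernel (c / √(w : ℝ)) (Θf w ω) x x'|}) atTop (𝓝 0) := by
  have hbound : ∀ w : ℕ, 1 ≤ w → ∫⁻ ω, ENNReal.ofReal ((ResDGN.ntk (Θf w ω) (Θv w ω) x x' -
      ResDGN.limitKernel (c / √(w : ℝ)) (Θf w ω) x x') ^ 2) ∂P w ≤
      ENNReal.ofReal (ResDGN.varianceBound b d c x x' / w) := fun w hw =>
    ResDGN.lintegral_sq_le (hΘv w) (hΘf w) (hiid w) (hlaw w) (hindep w)
      (f := fun p => ResDGN.ntk p.2 p.1 x x' - ResDGN.limitKernel (c / √(w : ℝ)) p.2 x x')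
      ((ResDGN.measurable_ntk hd measurable_snd measurable_fst x x').sub
        (ResDGN.measurable_limitKernel _ measurable_snd x x'))
      fun θ => ResDGN.avg_sq_ntk_sub_le hd hc hw x x' θ
  have hlim : Tendsto (fun w : ℕ => ENNReal.ofReal (ResDGN.varianceBound b d c x x' / w))
      atTop (𝓝 0) := by
    rw [← ENNReal.ofReal_zero]
    exact (ENNReal.continuous_ofReal.tendsto 0).comp (tendsto_const_div_atTop_nhds_zero_nat _)
  refine ⟨?_, fun ε hε => ?_⟩
  · have h := (ENNReal.continuous_rpow_const (y := (1 / 2 : ℝ))).tendsto 0 |>.comp hlim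
    rw [ENNReal.zero_rpow_of_pos (by norm_num)] at h
    refine tendsto_of_tendsto_of_tendsto_of_le_of_le' tendsto_const_nhds h
      (Eventually.of_forall fun _ => zero_le) ?_
    filter_upwards [eventually_ge_atTop 1] with w hw
    exact ResDGN.eLpNorm_two_le (hbound w hw)
  · have h := ENNReal.Tendsto.div_const hlim (b := ENNReal.ofReal (ε ^ 2))
      (Or.inr (by simpa using by positivity))
    rw [ENNReal.zero_div] at h
    refine tendsto_of_tendsto_of_tendsto_of_le_of_le' tendsto_const_nhds h
      (Eventually.of_forall fun _ => zero_le) ?_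
    filter_upwards [eventually_ge_atTop 1] with w hw
    exact ResDGN.measure_ge_le_of_lintegral_sq_le
      ((ResDGN.measurable_ntk hd (hΘf w) (hΘv w) x x').sub
        (ResDGN.measurable_limitKernel _ (hΘf w) x x')) hε (hbound w hw)
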